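/- **Setting.** Let $S\subset\mathbb R^2$ be open, bounded and simply connected (hence nonempty). Let $\lambda_0$ be the lowest eigenvalue of the Dirichlet Laplacian $-\Delta$ in $\mathcal H^1_0(S)$ and $u_0\in\mathcal H_0^1(S)$ the corresponding positive eigenfunction with $\int_S u_0^2\,dy=1$. With $Ry=(y_2,-y_1)$ put $$C_1=\int_S\langle\nabla u_0,Ry\rangle^2dy,\quad C_2=\int_S\langle\nabla u_0,y\rangle^2dy,\quad C_3=\int_S\langle\nabla u_0,Ry\rangle\langle\nabla u_0,y\rangle dy,\quad F=\Big(\int_S y_1u_0^2\,dy,\int_S y_2u_0^2\,dy\Big).$$ Let $r:\mathbb R\to\mathbb R^3$ be a simple $C^2$ curve parametrized by arc length, with curvature $k\ge 0$ and torsion $\tau$, and with an orthonormal frame $(r',N,B)$, $B=r'\times N$, satisfying the Frenet equations $r''=kN$, $N'=-kr'+\tau B$, $B'=-\tau N$. Let $\alpha:\mathbb R\to\mathbb R$ be differentiable with $\alpha(0)=0$, and assume that $k,\tau,\alpha'$ are bounded. Let $M>0$ and let $h:\mathbb R\to(0,\infty)$ be continuous, $C^1$ on $\mathbb R\setminus\{0\}$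 with $h'/h$ bounded there, such that $h(s)=M-s^2+O(|s|^3)$ as $s\to0$, $h(s)<h(0)$ for all $s\ne0$, and $\limsup_{|s|\to\infty}h(s)<M$. For $c\in\mathbb R$ and $\varepsilon>0$ define $$\vartheta=C_1(\tau+\alpha')^2+(C_2-1)\Big(\frac{h'}{h}\Big)^2-2C_3(\tau+\alpha')\frac{h'}{h},\qquad \zeta_\varepsilon=1-\varepsilon\,k\,h\,\langle(\cos\alpha,-\sin\alpha),F\rangle,$$ $$W_\varepsilon=\vartheta+c+\zeta_\varepsilon\Big(\frac{\lambda_0}{\varepsilon^2h^2}-\frac{\lambda_0}{\varepsilon^2M^2}\Big).$$ For a real potential $V$ on $\mathbb R$, the operator $-\frac{d^2}{ds^2}+V$ in $L^2(\mathbb R)$ acts on its natural domain, which consists of those $u\in\mathcal H^1(\mathbb R)$ whose weak derivative $u'$ is again weakly differentiable, with $-u''+Vu\in L^2(\mathbb R)$; for bounded $V$ this is $\mathcal H^2(\mathbb R)$. Let $$T_{\varepsilon,c}=-\frac{d^2}{ds^2}+W_\varepsilon,\qquad T=-\frac{d^2}{ds^2}+\frac{2\lambda_0}{M^3}s^2,\qquad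 \hat T_{\varepsilon,c}=\varepsilon J_\varepsilon T_{\varepsilon,c}J_\varepsilon^{-1},$$ where $J_\varepsilon$ is the unitary dilation $(J_\varepsilon\psi)(s)=\varepsilon^{1/4}\psi(\varepsilon^{1/2}s)$ of $L^2(\mathbb R)$. **Theorem.** For every $c\in\mathbb R$, the operator $T$ has a bounded, everywhere defined inverse on $L^2(\mathbb R)$, so does $\hat T_{\varepsilon,c}$ for all sufficiently small $\varepsilon>0$, and $$\big\|\hat T_{\varepsilon,c}^{-1}-T^{-1}\big\|\to0\qquad\text{as }\varepsilon\to0^+ .$$ -/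

import Mathlib

open MeasureTheory Filter Topology Set
open scoped ContDiff Gradient Matrix ENNReal

noncomputable section

namespace DeformedTube

/-! ### Operators in `L²(ℝ)` -/

/-- The complex Hilbert space `L²(ℝ)`. -/
abbrev L2 : Type := Lp ℂ 2 (volume : Measure ℝ)

/-- `v` is the weak (distributional) derivative of `u` on `ℝ`. -/
def HasWeakDeriv (u v : ℝ → ℂ) : Prop :=
  LocallyIntegrable u ∧ LocallyIntegrable v ∧
    ∀ φ : ℝ → ℝ, ContDiff ℝ ∞ φ → HasCompactSupport φ →
      ∫ s, deriv φ s • u s = -∫ s, φ s • v s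

theorem HasWeakDeriv.congr_add {u₁ u₂ u v₁ v₂ v : ℝ → ℂ} (h₁ : HasWeakDeriv u₁ v₁)
    (h₂ : HasWeakDeriv u₂ v₂) (hu : u =ᵐ[volume] u₁ + u₂) (hv : v =ᵐ[volume] v₁ + v₂) :
    HasWeakDeriv u v := by
  refine ⟨(h₁.1.add h₂.1).congr hu.symm, (h₁.2.1.add h₂.2.1).congr hv.symm, ?_⟩
  intro φ hφ hc
  have hφ' : Continuous (deriv φ) := hφ.continuous_deriv (by simp)
  have e₁ : ∫ s, deriv φ s • u s = ∫ s, (deriv φ s • u₁ s + deriv φ s • u₂ s) := by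
    refine integral_congr_ae ?_
    filter_upwards [hu] with s hs
    simp [hs]
  have e₂ : ∫ s, φ s • v s = ∫ s, (φ s • v₁ s + φ s • v₂ s) := by
    refine integral_congr_ae ?_
    filter_upwards [hv] with s hs
    simp [hs]
  rw [e₁, e₂, integral_add, integral_add, h₁.2.2 φ hφ hc, h₂.2.2 φ hφ hc, neg_add]
  · exact h₁.2.1.integrable_smul_left_of_hasCompactSupport hφ.continuous hc
  · exact h₂.2.1.integrable_smul_left_of_hasCompactSupport hφ.continuous hc
  · exact h₁.1.integrable_smul_left_of_hasCompactSupport hφ' hc.deriv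
  · exact h₂.1.integrable_smul_left_of_hasCompactSupport hφ' hc.deriv

theorem HasWeakDeriv.congr_smul {u₁ u v₁ v : ℝ → ℂ} (a : ℂ) (h₁ : HasWeakDeriv u₁ v₁)
    (hu : u =ᵐ[volume] a • u₁) (hv : v =ᵐ[volume] a • v₁) : HasWeakDeriv u v := by
  refine ⟨(h₁.1.smul a).congr hu.symm, (h₁.2.1.smul a).congr hv.symm, ?_⟩
  intro φ hφ hc
  have e₁ : ∫ s, deriv φ s • u s = ∫ s, a • (deriv φ s • u₁ s) := by
    refine integral_congr_ae ?_
    filter_upwards [hu] with s hs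
    simp [hs, mul_left_comm]
  have e₂ : ∫ s, φ s • v s = ∫ s, a • (φ s • v₁ s) := by
    refine integral_congr_ae ?_
    filter_upwards [hv] with s hs
    simp [hs, mul_left_comm]
  rw [e₁, e₂, integral_smul, integral_smul, h₁.2.2 φ hφ hc, smul_neg]

theorem HasWeakDeriv.ae_zero {u v : ℝ → ℂ} (h : HasWeakDeriv u v) (hu : u =ᵐ[volume] 0) :
    v =ᵐ[volume] 0 := by
  refine ae_eq_zero_of_integral_contDiff_smul_eq_zero h.2.1 ?_
  intro φ hφ hc
  have e : ∫ s, deriv φ s • u s = 0 := by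
    rw [← integral_zero ℝ ℂ (μ := volume)]
    refine integral_congr_ae ?_
    filter_upwards [hu] with s hs
    simp [hs]
  have := h.2.2 φ hφ hc
  rw [e] at this
  exact neg_eq_zero.mp this.symm

/-- The graph of `-d²/ds² + V`: the pairs `(u, f)` such that `u ∈ H¹(ℝ)`, the weak derivative `u'`
is itself weakly differentiable, and `-u'' + V u = f` almost everywhere. -/
def schrodingerGraph (V : ℝ → ℝ) : Submodule ℂ (L2 × L2) where
  carrier := {p | ∃ u₁ u₂ : ℝ → ℂ, HasWeakDeriv p.1 u₁ ∧ MemLp u₁ 2 volume ∧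
    HasWeakDeriv u₁ u₂ ∧ ∀ᵐ s : ℝ, p.2 s = -u₂ s + V s * p.1 s}
  add_mem' := by
    rintro ⟨u, f⟩ ⟨v, g⟩ ⟨u₁, u₂, h₁, h₂, h₃, h₄⟩ ⟨v₁, v₂, k₁, k₂, k₃, k₄⟩
    refine ⟨u₁ + v₁, u₂ + v₂, h₁.congr_add k₁ (Lp.coeFn_add u v) ae_eq_rfl, h₂.add k₂,
      h₃.congr_add k₃ ae_eq_rfl ae_eq_rfl, ?_⟩
    filter_upwards [h₄, k₄, Lp.coeFn_add u v, Lp.coeFn_add f g] with s a b c d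
    simp only [Prod.mk_add_mk, c, d, Pi.add_apply] at *
    rw [a, b]
    ring
  zero_mem' := by
    have hz : HasWeakDeriv 0 0 :=
      ⟨locallyIntegrable_zero, locallyIntegrable_zero, by intro φ _ _; simp⟩
    refine ⟨0, 0, ?_, MemLp.zero, hz, ?_⟩
    · refine hz.congr_smul 1 ?_ (by simp)
      simpa using Lp.coeFn_zero ℂ 2 (volume : Measure ℝ)
    · filter_upwards [Lp.coeFn_zero ℂ 2 (volume : Measure ℝ)] with s a
      simp only [Prod.fst_zero, Prod.snd_zero, a, Pi.zero_apply]
      simp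
  smul_mem' := by
    rintro a ⟨u, f⟩ ⟨u₁, u₂, h₁, h₂, h₃, h₄⟩
    refine ⟨a • u₁, a • u₂, h₁.congr_smul a (Lp.coeFn_smul a u) ae_eq_rfl, h₂.const_smul a,
      h₃.congr_smul a ae_eq_rfl ae_eq_rfl, ?_⟩
    filter_upwards [h₄, Lp.coeFn_smul a u, Lp.coeFn_smul a f] with s b c d
    simp only [Prod.smul_mk, c, d, Pi.smul_apply, smul_eq_mul] at *
    rw [b]
    ring

/-- The weak derivatives are unique, so `schrodingerGraph V` really is the graph of an operator. -/
theorem schrodingerGraph_snd_eq_zero (V : ℝ → ℝ) (p : L2 × L2) (hp : p ∈ schrodingerGraph V)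
    (h0 : p.1 = 0) : p.2 = 0 := by
  obtain ⟨u, f⟩ := p
  obtain ⟨u₁, u₂, h₁, -, h₃, h₄⟩ := hp
  simp only at h0 h₁ h₄ ⊢
  subst h0
  have z := Lp.coeFn_zero ℂ 2 (volume : Measure ℝ)
  have a := h₃.ae_zero (h₁.ae_zero z)
  refine Lp.ext ?_
  filter_upwards [h₄, z, a] with s h₄ z a
  rw [h₄, z, a]
  simp

/-- The Schrödinger operator `u ↦ -u'' + V u` in `L²(ℝ)` on its natural domain
`{u ∈ H¹(ℝ) : -u'' + V u ∈ L²(ℝ)}`. For bounded `V` this domain is `H²(ℝ)`. -/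
def schrodinger (V : ℝ → ℝ) : L2 →ₗ.[ℂ] L2 := (schrodingerGraph V).toLinearPMap

theorem schrodinger_graph (V : ℝ → ℝ) : (schrodinger V).graph = schrodingerGraph V :=
  Submodule.toLinearPMap_graph_eq _ (schrodingerGraph_snd_eq_zero V)

/-- `A` is a bounded, everywhere defined two-sided inverse of the operator `T`. -/
def IsBoundedInverse (T : L2 →ₗ.[ℂ] L2) (A : L2 →L[ℂ] L2) : Prop :=
  (∀ f : L2, ∃ h : A f ∈ T.domain, T ⟨A f, h⟩ = f) ∧ ∀ u : T.domain, A (T u) = u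

/-! ### The dilation -/

theorem eLpNorm_comp_mul {a : ℝ} (ha : 0 < a) {f : ℝ → ℂ} (hf : AEStronglyMeasurable f volume) :
    eLpNorm (fun s => f (a * s)) 2 volume
      = ENNReal.ofReal a⁻¹ ^ (1 / 2 : ℝ) * eLpNorm f 2 volume := by
  have hm := Real.map_volume_mul_left ha.ne'
  have hf' : AEStronglyMeasurable f (Measure.map (a * ·) volume) := by
    rw [hm]; exact hf.smul_measure _
  have := eLpNorm_map_measure (p := 2) hf' (by fun_prop : AEMeasurable (a * · : ℝ → ℝ) volume)
  rw [hm, eLpNorm_smul_measure_of_ne_top (by simp)] at this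
  simp only [Function.comp_def] at this
  rw [← this, abs_of_pos (inv_pos.mpr ha)]
  simp

theorem quasiMeasurePreserving_mul {a : ℝ} (ha : 0 < a) :
    Measure.QuasiMeasurePreserving (a * · : ℝ → ℝ) volume volume := by
  refine ⟨by fun_prop, ?_⟩
  rw [Real.map_volume_mul_left ha.ne']
  exact Measure.smul_absolutelyContinuous

theorem memLp_comp_mul {a : ℝ} (ha : 0 < a) {f : ℝ → ℂ} (hf : MemLp f 2 volume) :
    MemLp (fun s => f (a * s)) 2 volume := by
  refine ⟨hf.1.comp_quasiMeasurePreserving (quasiMeasurePreserving_mul ha), ?_⟩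
  rw [eLpNorm_comp_mul ha hf.1]
  exact ENNReal.mul_lt_top (ENNReal.rpow_lt_top_of_nonneg (by norm_num) (by simp)) hf.2

/-- The function `s ↦ ε^{1/4} ψ(ε^{1/2} s)` as an element of `L²(ℝ)`. -/
def dilationFun {ε : ℝ} (hε : 0 < ε) (ψ : L2) : L2 :=
  ((memLp_comp_mul (Real.sqrt_pos.mpr hε) (Lp.memLp ψ)).const_mul
    ((ε ^ (1 / 4 : ℝ) : ℝ) : ℂ)).toLp _

theorem dilationFun_coeFn {ε : ℝ} (hε : 0 < ε) (ψ : L2) :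
    dilationFun hε ψ =ᵐ[volume] fun s => ((ε ^ (1 / 4 : ℝ) : ℝ) : ℂ) * ψ (Real.sqrt ε * s) :=
  MemLp.coeFn_toLp _

theorem dilationFun_inv {ε δ : ℝ} (hε : 0 < ε) (hδ : 0 < δ) (h : ε * δ = 1) (ψ : L2) :
    dilationFun hε (dilationFun hδ ψ) = ψ := by
  refine Lp.ext ?_
  have h1 := (quasiMeasurePreserving_mul (Real.sqrt_pos.mpr hε)).ae (dilationFun_coeFn hδ ψ)
  filter_upwards [dilationFun_coeFn hε (dilationFun hδ ψ), h1] with s a b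
  rw [a, b, ← mul_assoc, ← Complex.ofReal_mul, ← Real.mul_rpow hε.le hδ.le, h, ← mul_assoc,
    ← Real.sqrt_mul hδ.le, mul_comm δ ε, h]
  simp

theorem norm_dilationFun {ε : ℝ} (hε : 0 < ε) (ψ : L2) : ‖dilationFun hε ψ‖ = ‖ψ‖ := by
  have hs := Real.sqrt_pos.mpr hε
  have key : ε ^ (1 / 4 : ℝ) * ((Real.sqrt ε)⁻¹) ^ (1 / 2 : ℝ) = 1 := by
    rw [Real.inv_rpow hs.le, Real.sqrt_eq_rpow, ← Real.rpow_mul hε.le]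
    norm_num
    exact mul_inv_cancel₀ (Real.rpow_pos_of_pos hε _).ne'
  rw [dilationFun, Lp.norm_toLp, Lp.norm_def]
  congr 1
  have := eLpNorm_const_smul (((ε ^ (1 / 4 : ℝ) : ℝ) : ℂ)) (fun s => ψ (Real.sqrt ε * s)) 2 volume
  simp only [Pi.smul_def, smul_eq_mul] at this
  rw [this, eLpNorm_comp_mul hs (Lp.aestronglyMeasurable ψ), ← mul_assoc]
  have e : ‖((ε ^ (1 / 4 : ℝ) : ℝ) : ℂ)‖ₑ = ENNReal.ofReal (ε ^ (1 / 4 : ℝ)) := by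
    rw [← ofReal_norm, Complex.norm_real, Real.norm_of_nonneg (by positivity)]
  rw [e, ENNReal.ofReal_rpow_of_nonneg (by positivity) (by norm_num),
    ← ENNReal.ofReal_mul (by positivity), key]
  simp

/-- The unitary dilation `(J_ε ψ)(s) = ε^{1/4} ψ(ε^{1/2} s)` of `L²(ℝ)` for `ε > 0`
(and the identity for the irrelevant values `ε ≤ 0`). -/
def dilation (ε : ℝ) : L2 ≃ₗᵢ[ℂ] L2 :=
  if hε : 0 < ε then
    { toFun := dilationFun hε
      invFun := dilationFun (inv_pos.mpr hε)
      left_inv := dilationFun_inv (inv_pos.mpr hε) hε (inv_mul_cancel₀ hε.ne')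
      right_inv := dilationFun_inv hε (inv_pos.mpr hε) (mul_inv_cancel₀ hε.ne')
      map_add' := by
        intro ψ χ
        refine Lp.ext ?_
        have h1 := (quasiMeasurePreserving_mul (Real.sqrt_pos.mpr hε)).ae (Lp.coeFn_add ψ χ)
        filter_upwards [dilationFun_coeFn hε (ψ + χ), dilationFun_coeFn hε ψ,
          dilationFun_coeFn hε χ, h1, Lp.coeFn_add (dilationFun hε ψ) (dilationFun hε χ)]
          with s a b c d e
        rw [a, d, e, Pi.add_apply, Pi.add_apply, b, c, mul_add]
      map_smul' := by
        intro z ψ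
        refine Lp.ext ?_
        have h1 := (quasiMeasurePreserving_mul (Real.sqrt_pos.mpr hε)).ae (Lp.coeFn_smul z ψ)
        filter_upwards [dilationFun_coeFn hε (z • ψ), dilationFun_coeFn hε ψ, h1,
          Lp.coeFn_smul z (dilationFun hε ψ)] with s a b c d
        rw [RingHom.id_apply, a, c, d, Pi.smul_apply, Pi.smul_apply, b, smul_eq_mul, smul_eq_mul,
          mul_left_comm]
      norm_map' := norm_dilationFun hε }
  else LinearIsometryEquiv.refl ℂ L2

theorem dilation_coeFn {ε : ℝ} (hε : 0 < ε) (ψ : L2) :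
    dilation ε ψ =ᵐ[volume] fun s => ((ε ^ (1 / 4 : ℝ) : ℝ) : ℂ) * ψ (Real.sqrt ε * s) := by
  have : dilation ε ψ = dilationFun hε ψ := by
    unfold dilation
    rw [dif_pos hε]
    rfl
  rw [this]
  exact dilationFun_coeFn hε ψ

/-- The operator `ε J_ε T J_ε⁻¹`, with domain `J_ε (dom T)`. -/
def rescaled (ε : ℝ) (T : L2 →ₗ.[ℂ] L2) : L2 →ₗ.[ℂ] L2 where
  domain := T.domain.comap ((dilation ε).symm.toLinearEquiv : L2 →ₗ[ℂ] L2)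
  toFun :=
    { toFun := fun u => (ε : ℂ) • dilation ε (T ⟨(dilation ε).symm (u : L2), u.2⟩)
      map_add' := by
        intro u v
        rw [← smul_add, ← map_add, ← T.map_add]
        congr 3
        exact Subtype.ext (map_add (dilation ε).symm (u : L2) v)
      map_smul' := by
        intro z u
        rw [RingHom.id_apply, smul_comm z (ε : ℂ), ← map_smul (dilation ε) z, ← T.map_smul]
        congr 3
        exact Subtype.ext (map_smul (dilation ε).symm z (u : L2)) }

/-! ### The cross section and its Dirichlet ground state -/

/-- The Euclidean plane. -/
abbrev E2 : Type := EuclideanSpace ℝ (Fin 2)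

/-- Euclidean three-space. -/
abbrev E3 : Type := EuclideanSpace ℝ (Fin 3)

/-- The cross sections: open, bounded, simply connected (in particular nonempty) plane regions. -/
structure IsCrossSection (S : Set E2) : Prop where
  isOpen : IsOpen S
  isBounded : Bornology.IsBounded S
  isSimplyConnected : IsSimplyConnected S

/-- Real test functions on the open set `S`. -/
def IsTestFunction (S : Set E2) (φ : E2 → ℝ) : Prop :=
  ContDiff ℝ ∞ φ ∧ HasCompactSupport φ ∧ tsupport φ ⊆ S

/-- `u ∈ H¹₀(S)` with weak gradient `g`: the pair `(u, g)` is a limit in `L²(S)` of pairs `(φ, ∇φ)`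
with `φ` a test function on `S`. -/
def MemH10 (S : Set E2) (u : E2 → ℝ) (g : E2 → E2) : Prop :=
  MemLp u 2 (volume.restrict S) ∧ MemLp g 2 (volume.restrict S) ∧
    ∃ φ : ℕ → E2 → ℝ, (∀ n, IsTestFunction S (φ n)) ∧
      Tendsto (fun n => eLpNorm (φ n - u) 2 (volume.restrict S)) atTop (𝓝 0) ∧
      Tendsto (fun n => eLpNorm (∇ (φ n) - g) 2 (volume.restrict S)) atTop (𝓝 0)

/-- `u ∈ H¹₀(S)`, with weak gradient `g`, solves `-Δ u = μ u` weakly in `S`. -/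
def IsDirichletSolution (S : Set E2) (μ : ℝ) (u : E2 → ℝ) (g : E2 → E2) : Prop :=
  MemH10 S u g ∧ ∀ φ : E2 → ℝ, IsTestFunction S φ →
    ∫ y in S, inner ℝ (g y) (∇ φ y) = μ * ∫ y in S, u y * φ y

/-- `μ` is an eigenvalue of the Dirichlet Laplacian `-Δ` in `S`. -/
def IsDirichletEigenvalue (S : Set E2) (μ : ℝ) : Prop :=
  ∃ u g, IsDirichletSolution S μ u g ∧ ¬ u =ᵐ[volume.restrict S] 0

/-- `lam0` is the lowest Dirichlet eigenvalue of `S`, and `u0` is the corresponding positive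
normalized eigenfunction, with weak gradient `Du0`. -/
structure IsGroundState (S : Set E2) (lam0 : ℝ) (u0 : E2 → ℝ) (Du0 : E2 → E2) : Prop where
  isLeast : IsLeast {μ | IsDirichletEigenvalue S μ} lam0
  solution : IsDirichletSolution S lam0 u0 Du0
  normalized : ∫ y in S, u0 y ^ 2 = 1
  pos : ∀ᵐ y ∂(volume.restrict S), 0 < u0 y

/-- The rotation `R y = (y₂, -y₁)`. -/
def rot (y : E2) : E2 := !₂[y 1, -y 0]

/-- `C₁(S) = ∫_S ⟨∇u₀, R y⟩² dy`. -/
def C1 (S : Set E2) (Du0 : E2 → E2) : ℝ := ∫ y in S, inner ℝ (Du0 y) (rot y) ^ 2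

/-- `C₂(S) = ∫_S ⟨∇u₀, y⟩² dy`. -/
def C2 (S : Set E2) (Du0 : E2 → E2) : ℝ := ∫ y in S, inner ℝ (Du0 y) y ^ 2

/-- `C₃(S) = ∫_S ⟨∇u₀, R y⟩ ⟨∇u₀, y⟩ dy`. -/
def C3 (S : Set E2) (Du0 : E2 → E2) : ℝ :=
  ∫ y in S, inner ℝ (Du0 y) (rot y) * inner ℝ (Du0 y) y

/-- `F(S) = (∫_S y₁ u₀² dy, ∫_S y₂ u₀² dy)`. -/
def FS (S : Set E2) (u0 : E2 → ℝ) : E2 :=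
  !₂[∫ y in S, y 0 * u0 y ^ 2, ∫ y in S, y 1 * u0 y ^ 2]

/-! ### The reference curve and the deformation function -/

/-- `r` is a simple `C²` curve parametrized by arc length, with curvature `k` and torsion `τ`, such
that the Frenet equations hold for the orthonormal frame `(T, N, B)`, where `T = r'` and
`B = T × N`. (Where `k ≠ 0`, the normal vector is `T' / k`.) -/
structure IsFrenetCurve (r N B : ℝ → E3) (k τ : ℝ → ℝ) : Prop where
  contDiff : ContDiff ℝ 2 r
  simple : Function.Injective r
  arcLength : ∀ s, ‖deriv r s‖ = 1
  norm_normal : ∀ s, ‖N s‖ = 1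
  orthogonal : ∀ s, inner ℝ (deriv r s) (N s) = 0
  binormal : ∀ s, B s = WithLp.toLp 2 ((deriv r s).ofLp ⨯₃ (N s).ofLp)
  curvature_nonneg : ∀ s, 0 ≤ k s
  frenet_T : ∀ s, HasDerivAt (deriv r) (k s • N s) s
  frenet_N : ∀ s, HasDerivAt N (-k s • deriv r s + τ s • B s) s
  frenet_B : ∀ s, HasDerivAt B (-τ s • N s) s

/-- The deformation functions `h` on `ℝ` with maximum `M`. -/
structure IsDeformation (h : ℝ → ℝ) (M : ℝ) : Prop where
  continuous : Continuous h
  pos : ∀ s, 0 < h s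
  contDiffOn : ContDiffOn ℝ 1 h {0}ᶜ
  bounded_log_deriv : ∃ C, ∀ s, s ≠ 0 → |deriv h s / h s| ≤ C
  max_pos : 0 < M
  expansion : (fun s => h s - (M - s ^ 2)) =O[𝓝 0] fun s => |s| ^ 3
  single_max : ∀ s, s ≠ 0 → h s < h 0
  limsup_lt : limsup h (cocompact ℝ) < M

/-! ### The effective potential -/

/-- `ϑ = C₁(S) (τ + α')² + (C₂(S) - 1) (h'/h)² - 2 C₃(S) (τ + α') h'/h`. -/
def vartheta (S : Set E2) (Du0 : E2 → E2) (τ α h : ℝ → ℝ) (s : ℝ) : ℝ :=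
  C1 S Du0 * (τ s + deriv α s) ^ 2 + (C2 S Du0 - 1) * (deriv h s / h s) ^ 2
    - 2 * C3 S Du0 * (τ s + deriv α s) * (deriv h s / h s)

/-- `z_α = (cos α, -sin α)`. -/
def zvec (α : ℝ → ℝ) (s : ℝ) : E2 := !₂[Real.cos (α s), -Real.sin (α s)]

/-- `ζ_ε = 1 - ε k h ⟨z_α, F(S)⟩`. -/
def zeta (S : Set E2) (u0 : E2 → ℝ) (k α h : ℝ → ℝ) (ε s : ℝ) : ℝ :=
  1 - ε * k s * h s * inner ℝ (zvec α s) (FS S u0)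

/-- `W_ε = ϑ + c + ζ_ε (λ₀ / (ε² h²) - λ₀ / (ε² M²))`. -/
def Wpot (S : Set E2) (lam0 : ℝ) (u0 : E2 → ℝ) (Du0 : E2 → E2) (k τ α h : ℝ → ℝ) (M c ε s : ℝ) :
    ℝ :=
  vartheta S Du0 τ α h s + c
    + zeta S u0 k α h ε s * (lam0 / (ε ^ 2 * h s ^ 2) - lam0 / (ε ^ 2 * M ^ 2))

end DeformedTube

end

noncomputable section

namespace DeformedTube

/-! ### Weak derivatives -/

/-! Conjugation by the dilation turns `T_{ε,c}` into `-d²/ds² + V_ε` with `V_ε(s) = ε W_ε(√ε s)`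
(`scaledPot`). The bounded part `ϑ + c` contributes `O(ε)`. Since `1/h² - 1/M² = 2s²/M³ + o(s²)` at
`0` and `ζ_ε = 1 + O(ε)`, the rest tends to `2λ₀s²/M³` uniformly on bounded intervals. Because `h`
stays away from `M` off the origin and `λ₀ > 0` (`IsGroundState.lam0_pos`), also `V_ε ≥ -Cε + b
min(s², 1/ε)`. Potentials that converge locally uniformly and confine uniformly have inverses
converging in norm (`exists_inverse_tendsto`).

The `V_ε` need not be positive near `0`, so a bound on the inverses uniform in `ε` has to use the
kinetic energy. For bounded smooth `φ` and `P = V + φ' - φ²`, integration by parts turns `∫ |u'|² +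
V|u|²` into `‖u' + φu‖² + ‖√P u‖²`. With `φ = s/(s² + ρ²)` the correction `φ' - φ²` is positive
where the well is shallow and only mildly negative elsewhere, so `P ≥ c > 0` with `c` independent of
`ε` (`wellFun_coercive`).

The form domain embeds as a closed subspace of `L² × L²` by `u ↦ (u' + φu, √P u)`. If `ι` maps it
back to `L²`, then `ι ι*` is the inverse of the form operator (`IsFormData.exists_isFormInverse`).
It inverts the operator on the whole natural domain because `-u'' + Vu = 0` has no nonzero solution
there (`eq_zero_of_mem_schrodingerGraph`).

Two inverses are compared in weak form with a cutoff `χ` (`IsFormInverse.norm_sub_le`): where `χ ≠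
1` the factor `1/√P` is small, the commutators carry the small `χ'`, and on the support of `χ` the
potentials are close. -/

theorem hasWeakDeriv_of_contDiff {f : ℝ → ℂ} (hf : ContDiff ℝ 1 f) :
    HasWeakDeriv f (deriv f) := by
  have hf' : Continuous (deriv f) := hf.continuous_deriv le_rfl
  refine ⟨hf.continuous.locallyIntegrable, hf'.locallyIntegrable, ?_⟩
  intro φ hφ hc
  have hφ' : Continuous (deriv φ) := hφ.continuous_deriv (by simp)
  have i₁ : Integrable (fun s => φ s • deriv f s) :=
    (hφ.continuous.smul hf').integrable_of_hasCompactSupport hc.smul_right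
  have i₂ : Integrable (fun s => deriv φ s • f s) :=
    (hφ'.smul hf.continuous).integrable_of_hasCompactSupport hc.deriv.smul_right
  have i₃ : Integrable (fun s => φ s • f s) :=
    (hφ.continuous.smul hf.continuous).integrable_of_hasCompactSupport hc.smul_right
  have := integral_eq_zero_of_hasDerivAt_of_integrable
    (fun s => ((hφ.differentiable (by simp) s).hasDerivAt.fun_smul
      (hf.differentiable one_ne_zero s).hasDerivAt)) (i₁.add i₂) i₃
  rw [integral_add i₁ i₂] at this
  exact eq_neg_of_add_eq_zero_right this

theorem HasWeakDeriv.smooth_smul {u v : ℝ → ℂ} (h : HasWeakDeriv u v) {χ : ℝ → ℝ}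
    (hχ : ContDiff ℝ ∞ χ) :
    HasWeakDeriv (fun s => χ s • u s) (fun s => deriv χ s • u s + χ s • v s) := by
  have hχ' : ContDiff ℝ ∞ (deriv χ) := hχ.deriv'
  have l : ∀ {g : ℝ → ℝ} {w : ℝ → ℂ}, Continuous g → LocallyIntegrable w →
      LocallyIntegrable (fun s => g s • w s) := fun hg hw => by
    rw [← locallyIntegrableOn_univ] at hw ⊢
    exact hw.continuousOn_smul isOpen_univ.isLocallyClosed hg.continuousOn
  refine ⟨l hχ.continuous h.1, (l hχ'.continuous h.1).add (l hχ.continuous h.2.1), ?_⟩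
  intro φ hφ hc
  have key := h.2.2 (fun s => φ s * χ s) (hφ.mul hχ) hc.mul_right
  have hd : ∀ s, deriv (fun s => φ s * χ s) s = deriv φ s * χ s + φ s * deriv χ s := fun s =>
    deriv_fun_mul (hφ.differentiable (by simp) s) (hχ.differentiable (by simp) s)
  have i : ∀ {g : ℝ → ℝ} {w : ℝ → ℂ}, Continuous g → HasCompactSupport g →
      LocallyIntegrable w → Integrable (fun s => g s • w s) := fun hg hgc hw =>
    hw.integrable_smul_left_of_hasCompactSupport hg hgc
  have hφ' : Continuous (deriv φ) := hφ.continuous_deriv (by simp)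
  have i₁ : Integrable (fun s => (deriv φ s * χ s) • u s) :=
    i (hφ'.mul hχ.continuous) hc.deriv.mul_right h.1
  have i₂ : Integrable (fun s => (φ s * deriv χ s) • u s) :=
    i (hφ.continuous.mul hχ'.continuous) hc.mul_right h.1
  have i₃ : Integrable (fun s => (φ s * χ s) • v s) :=
    i (hφ.continuous.mul hχ.continuous) hc.mul_right h.2.1
  simp only [hd, add_smul] at key
  rw [integral_add i₁ i₂] at key
  simp only [smul_add, smul_smul]
  rw [integral_add i₂ i₃, neg_add, ← key]
  ring

theorem HasWeakDeriv.comp_mul {u v : ℝ → ℂ} (h : HasWeakDeriv u v) {a : ℝ} (ha : 0 < a) :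
    HasWeakDeriv (fun s => u (a * s)) (fun s => (a : ℂ) • v (a * s)) := by
  have l : ∀ {w : ℝ → ℂ}, LocallyIntegrable w → LocallyIntegrable (fun s => w (a * s)) := by
    intro w hw
    rw [locallyIntegrable_iff] at hw ⊢
    intro K hK
    have hK' : IsCompact ((fun s => a * s) '' K) := hK.image (by fun_prop)
    have := hw _ hK'
    rw [← integrable_indicator_iff hK'.measurableSet] at this
    rw [← integrable_indicator_iff hK.measurableSet]
    refine (this.comp_mul_left' ha.ne').congr (ae_of_all _ fun s => ?_)
    by_cases hs : s ∈ K
    · simp [indicator, hs, ha.ne']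
    · simp [indicator, hs, ha.ne']
  refine ⟨l h.1, (l h.2.1).smul (a : ℂ), ?_⟩
  intro φ hφ hc
  have hφ₁ : ContDiff ℝ ∞ (fun s => φ (a⁻¹ * s)) := hφ.comp (contDiff_const.mul contDiff_id)
  have hc₁ : HasCompactSupport (fun s => φ (a⁻¹ * s)) :=
    hc.comp_homeomorph (Homeomorph.mulLeft₀ a⁻¹ (inv_ne_zero ha.ne'))
  have key := h.2.2 _ hφ₁ hc₁
  have hd : ∀ s, deriv (fun s => φ (a⁻¹ * s)) s = a⁻¹ * deriv φ (a⁻¹ * s) := fun s => by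
    rw [deriv_comp_mul_left]; simp
  have e₁ := Measure.integral_comp_mul_left (fun s => deriv φ (a⁻¹ * s) • u s) a
  have e₂ := Measure.integral_comp_mul_left (fun s => φ (a⁻¹ * s) • v s) a
  simp only [inv_mul_cancel_left₀ ha.ne'] at e₁ e₂
  simp only [hd, mul_smul] at key
  rw [integral_smul] at key
  have e₃ : ∫ s, φ s • (a : ℂ) • v (a * s) = (a : ℂ) • ∫ s, φ s • v (a * s) := by
    rw [← integral_smul]
    exact integral_congr_ae (ae_of_all _ fun s => smul_comm _ _ _)
  rw [e₃, e₁, e₂]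
  have : ∫ s, deriv φ (a⁻¹ * s) • u s = -(a • ∫ s, φ (a⁻¹ * s) • v s) := by
    rw [← smul_neg, ← key, smul_inv_smul₀ ha.ne']
  rw [this, smul_neg, smul_comm (a : ℂ), Complex.coe_smul]

/-- `v` is the weak derivative of the real function `u`. -/
def HasRealWeakDeriv (u v : ℝ → ℝ) : Prop :=
  LocallyIntegrable u ∧ LocallyIntegrable v ∧
    ∀ φ : ℝ → ℝ, ContDiff ℝ ∞ φ → HasCompactSupport φ →
      ∫ s, deriv φ s * u s = -∫ s, φ s * v s

/-- Used with the real and imaginary parts, so that uniqueness can be proved by monotonicity of a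
real function. -/
theorem HasWeakDeriv.clm_comp {u v : ℝ → ℂ} (h : HasWeakDeriv u v) (L : ℂ →L[ℝ] ℝ) :
    HasRealWeakDeriv (fun s => L (u s)) (fun s => L (v s)) := by
  have l : ∀ {w : ℝ → ℂ}, LocallyIntegrable w → LocallyIntegrable (fun s => L (w s)) := by
    intro w hw x
    obtain ⟨U, hU, hi⟩ := hw x
    exact ⟨U, hU, L.integrable_comp hi⟩
  refine ⟨l h.1, l h.2.1, fun φ hφ hc => ?_⟩
  have key := congrArg L (h.2.2 φ hφ hc)
  rw [map_neg, ← L.integral_comp_comm, ← L.integral_comp_comm] at key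
  · simpa only [map_smul, smul_eq_mul] using key
  · exact h.2.1.integrable_smul_left_of_hasCompactSupport hφ.continuous hc
  · exact h.1.integrable_smul_left_of_hasCompactSupport (hφ.continuous_deriv (by simp)) hc.deriv

/-! ### Absolutely continuous representatives of weakly differentiable functions. -/

theorem exists_support_subset_Ioc {f : ℝ → ℝ} (hf : HasCompactSupport f) :
    ∃ n : ℝ, 0 < n ∧ ∀ m, n ≤ m → Function.support f ⊆ Ioc (-m) m := by
  obtain ⟨n, hn⟩ := hf.isCompact.isBounded.subset_ball 0
  refine ⟨max n 1, by positivity, fun m hm x hx => ?_⟩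
  have := hn (subset_tsupport f hx)
  rw [mem_ball_zero_iff, Real.norm_eq_abs, abs_lt] at this
  have := le_max_left n 1
  constructor <;> linarith

/-- A test function with vanishing integral is the derivative of a test function. -/
theorem exists_test_primitive {η : ℝ → ℝ} (hη : ContDiff ℝ ∞ η) (hc : HasCompactSupport η)
    (h0 : ∫ s, η s = 0) : ∃ φ : ℝ → ℝ, ContDiff ℝ ∞ φ ∧ HasCompactSupport φ ∧ deriv φ = η := by
  obtain ⟨n, hn0, hn⟩ := exists_support_subset_Ioc hc
  have hs := hn n le_rfl
  have hd : ∀ x, HasDerivAt (fun x => ∫ t in (-n)..x, η t) (η x) x := fun x =>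
    hη.continuous.integral_hasStrictDerivAt (-n) x |>.hasDerivAt
  have hd' : deriv (fun x => ∫ t in (-n)..x, η t) = η := funext fun x => (hd x).deriv
  refine ⟨fun x => ∫ t in (-n)..x, η t, ?_, ?_, hd'⟩
  · rw [contDiff_infty_iff_deriv, hd']
    exact ⟨fun x => (hd x).differentiableAt, hη⟩
  · refine HasCompactSupport.intro (isCompact_Icc (a := -n) (b := n)) fun x hx => ?_
    rcases lt_or_ge x (-n) with h | h
    · rw [intervalIntegral.integral_symm, neg_eq_zero]
      refine intervalIntegral.integral_zero_ae (ae_of_all _ fun t ht => ?_)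
      by_contra h'
      rw [uIoc_of_le h.le] at ht
      exact absurd (hs h').1 (not_lt.mpr ht.2)
    · have hx' : n < x := by
        by_contra h'
        exact hx ⟨h, not_lt.mp h'⟩
      rw [intervalIntegral.integral_eq_integral_of_support_subset, h0]
      exact hs.trans (Ioc_subset_Ioc le_rfl hx'.le)

/-- **The du Bois-Reymond lemma**: a function with vanishing weak derivative is constant. -/
theorem ae_eq_const_of_integral_deriv_mul_eq_zero {g : ℝ → ℝ} (hg : LocallyIntegrable g)
    (h : ∀ φ : ℝ → ℝ, ContDiff ℝ ∞ φ → HasCompactSupport φ → ∫ s, deriv φ s * g s = 0) :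
    ∃ c : ℝ, g =ᵐ[volume] fun _ => c := by
  let b : ContDiffBump (0 : ℝ) := default
  set θ : ℝ → ℝ := b.normed volume
  have hθ : ContDiff ℝ ∞ θ := b.contDiff_normed
  have hθc : HasCompactSupport θ := b.hasCompactSupport_normed
  have hθ1 : ∫ s, θ s = 1 := b.integral_normed
  refine ⟨∫ s, θ s * g s, ae_eq_of_integral_contDiff_smul_eq hg
    (locallyIntegrable_const _) fun ψ hψ hψc => ?_⟩
  have iθ := hθ.continuous.integrable_of_hasCompactSupport hθc (μ := volume)
  have iψ := hψ.continuous.integrable_of_hasCompactSupport hψc (μ := volume)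
  have iθg := hg.integrable_smul_left_of_hasCompactSupport hθ.continuous hθc
  have iψg := hg.integrable_smul_left_of_hasCompactSupport hψ.continuous hψc
  -- Subtracting a multiple of the unit-mass bump makes the integral vanish, so the difference is an
  -- admissible `φ'`.
  obtain ⟨φ, hφ, hφc, hd⟩ := exists_test_primitive (η := fun s => ψ s - (∫ t, ψ t) * θ s)
    (hψ.sub (contDiff_const.mul hθ)) (hψc.sub (hθc.mul_left)) (by
      rw [integral_sub iψ (iθ.const_mul _), integral_const_mul, hθ1]; ring)
  have key := h φ hφ hφc
  simp only [smul_eq_mul] at iθg iψg ⊢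
  rw [hd] at key
  simp only [sub_mul, mul_assoc] at key
  rw [integral_sub iψg (iθg.const_mul _), integral_const_mul] at key
  rw [integral_mul_const]
  linarith

/-- A continuous representative of a weakly differentiable function. -/
structure IsPrimitive (X v : ℝ → ℝ) : Prop where
  ac : ∀ a b, AbsolutelyContinuousOnInterval X a b
  ae_hasDerivAt : ∀ᵐ x, HasDerivAt X (v x) x

theorem isPrimitive_integral {v : ℝ → ℝ} (hv : LocallyIntegrable v) (c : ℝ) :
    IsPrimitive (fun x => c + ∫ t in (0)..x, v t) v := by
  have hi : ∀ a b, IntervalIntegrable v volume a b := fun a b =>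
    (hv.integrableOn_isCompact isCompact_uIcc).intervalIntegrable
  constructor
  · intro a b
    set n := max |a| |b|
    have hn : uIcc a b ⊆ uIcc (-n) n := by
      have ha := abs_le.mp (le_max_left |a| |b|)
      have hb := abs_le.mp (le_max_right |a| |b|)
      rw [uIcc_of_le (by linarith [ha.1, ha.2] : -n ≤ n)]
      exact uIcc_subset_Icc ha hb
    have h0 : (0 : ℝ) ∈ uIcc (-n) n := by
      have : 0 ≤ n := (abs_nonneg a).trans (le_max_left _ _)
      rw [uIcc_of_le (by linarith)]
      constructor <;> linarith
    have hc : AbsolutelyContinuousOnInterval (fun _ : ℝ => c) (-n) n :=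
      contDiffOn_const.absolutelyContinuousOnInterval
    exact (hc.add ((hi (-n) n).absolutelyContinuousOnInterval_intervalIntegral h0)).mono hn
  · have : ∀ᵐ x, ∀ n : ℕ, x ∈ uIcc (-n : ℝ) n →
        HasDerivAt (fun x => ∫ t in (0)..x, v t) (v x) x := by
      rw [ae_all_iff]
      intro n
      filter_upwards [(hi (-n) n).ae_hasDerivAt_integral] with x hx hxn
      refine hx hxn 0 ?_
      rw [uIcc_of_le (by linarith [n.cast_nonneg (α := ℝ)])]
      constructor <;> linarith [n.cast_nonneg (α := ℝ)]
    filter_upwards [this] with x hx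
    obtain ⟨n, hn⟩ := exists_nat_ge |x|
    refine (hx n ?_).const_add c
    rw [uIcc_of_le (by linarith [n.cast_nonneg (α := ℝ)])]
    exact abs_le.mp hn

theorem IsPrimitive.integral_deriv_mul {X v : ℝ → ℝ} (h : IsPrimitive X v) {φ : ℝ → ℝ}
    (hφ : ContDiff ℝ ∞ φ) (hc : HasCompactSupport φ) :
    ∫ s, deriv φ s * X s = -∫ s, φ s * v s := by
  obtain ⟨n, hn0, hn⟩ := exists_support_subset_Ioc hc
  obtain ⟨m, hm0, hm⟩ := exists_support_subset_Ioc hc.deriv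
  -- The extra `1` places `±N` strictly outside the support of `φ`, so the boundary terms vanish.
  set N := max n m + 1
  have hN := hn N ((le_max_left n m).trans (lt_add_one _).le)
  have hN' := hm N ((le_max_right n m).trans (lt_add_one _).le)
  have hb : ∀ x, n < |x| → φ x = 0 := fun x hx => by
    by_contra h'
    have := hn n le_rfl h'
    exact absurd (abs_le.mpr ⟨this.1.le, this.2⟩) (not_le.mpr hx)
  have hnN : n < N := lt_of_le_of_lt (le_max_left n m) (lt_add_one _)
  have hφac : AbsolutelyContinuousOnInterval φ (-N) N :=
    (hφ.of_le (by simp)).contDiffOn.absolutelyContinuousOnInterval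
  have key := (h.ac (-N) N).integral_mul_deriv_eq_deriv_mul hφac
  rw [hb N (by rwa [abs_of_pos (hn0.trans hnN)]),
    hb (-N) (by rwa [abs_neg, abs_of_pos (hn0.trans hnN)])] at key
  simp only [mul_zero, sub_zero, zero_sub] at key
  rw [← intervalIntegral.integral_eq_integral_of_support_subset (a := -N) (b := N),
    ← intervalIntegral.integral_eq_integral_of_support_subset (a := -N) (b := N)]
  · simp only [mul_comm (deriv φ _), key]
    congr 1
    refine intervalIntegral.integral_congr_ae ?_
    filter_upwards [h.ae_hasDerivAt] with x hx _
    rw [hx.deriv, mul_comm]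
  · exact (Function.support_mul_subset_left _ _).trans hN
  · exact (Function.support_mul_subset_left _ _).trans hN'

theorem IsPrimitive.continuous {X v : ℝ → ℝ} (h : IsPrimitive X v) : Continuous X := by
  rw [continuous_iff_continuousAt]
  intro x
  refine (h.ac (x - 1) (x + 1)).continuousOn.continuousAt ?_
  rw [uIcc_of_le (by linarith)]
  exact Icc_mem_nhds (by linarith) (by linarith)

/-- The difference of `u` and a primitive of `v` has zero weak derivative, hence is constant. -/
theorem HasRealWeakDeriv.exists_isPrimitive {u v : ℝ → ℝ} (h : HasRealWeakDeriv u v) :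
    ∃ X, u =ᵐ[volume] X ∧ IsPrimitive X v := by
  have hX := isPrimitive_integral h.2.1 0
  obtain ⟨c, hc⟩ := ae_eq_const_of_integral_deriv_mul_eq_zero
    (h.1.sub hX.continuous.locallyIntegrable) (fun φ hφ hφc => by
      have hφ' := hφ.continuous_deriv (by simp)
      have e : ∀ s, deriv φ s * (u - fun x => 0 + ∫ t in (0)..x, v t) s
          = deriv φ s * u s - deriv φ s * (0 + ∫ t in (0)..s, v t) := fun s => by
        rw [Pi.sub_apply, mul_sub]
      simp only [e]
      rw [integral_sub, h.2.2 φ hφ hφc, hX.integral_deriv_mul hφ hφc, sub_self]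
      · exact h.1.integrable_smul_left_of_hasCompactSupport hφ' hφc.deriv
      · exact hX.continuous.locallyIntegrable.integrable_smul_left_of_hasCompactSupport hφ'
          hφc.deriv)
  refine ⟨_, ?_, isPrimitive_integral h.2.1 c⟩
  filter_upwards [hc] with x hx
  rw [Pi.sub_apply] at hx
  linarith

/-! ### Uniqueness of square integrable solutions. -/

/-- A monotone integrable function on the line vanishes. -/
theorem _root_.Monotone.eq_zero_of_integrable {G : ℝ → ℝ} (hG : Monotone G) (hi : Integrable G) :
    G = 0 := by
  -- By Chebyshev, `|G| ≥ c > 0` cannot hold on a half-line; monotonicity propagates any nonzero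
  -- value along one.
  have aux : ∀ {c : ℝ} {s : Set ℝ}, 0 < c → MeasurableSet s → volume s = ⊤ →
      ¬ ∀ x ∈ s, c ≤ |G x| := by
    intro c s hc hs hv h
    have := hi.norm.measure_norm_ge_lt_top hc
    rw [lt_top_iff_ne_top] at this
    refine this (top_unique (hv ▸ measure_mono fun x hx => ?_))
    simpa using h x hx
  funext a
  rcases lt_trichotomy (G a) 0 with h | h | h
  · refine absurd (fun x hx => ?_) (aux (neg_pos.mpr h) measurableSet_Iic (Real.volume_Iic (a := a)))
    exact (neg_le_neg (hG hx)).trans (neg_le_abs _)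
  · exact h
  · refine absurd (fun x hx => ?_) (aux h measurableSet_Ici (Real.volume_Ici (a := a)))
    exact (hG hx).trans (le_abs_self _)

/-- Uniqueness for the first order system `x' = y - φ x`, `y' = P x + φ y` in `L²(ℝ)`. -/
theorem ae_zero_of_first_order_system {x y φ P : ℝ → ℝ} {c : ℝ} (hc : 0 < c) (hP : ∀ s, c ≤ P s)
    (hx : MemLp x 2) (hy : MemLp y 2)
    (hx' : HasRealWeakDeriv x (fun s => y s - φ s * x s))
    (hy' : HasRealWeakDeriv y (fun s => P s * x s + φ s * y s)) : x =ᵐ[volume] 0 := by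
  obtain ⟨X, hX, pX⟩ := hx'.exists_isPrimitive
  obtain ⟨Y, hY, pY⟩ := hy'.exists_isPrimitive
  have hXY : ∀ a b, AbsolutelyContinuousOnInterval (X * Y) a b := fun a b =>
    (pX.ac a b).mul (pY.ac a b)
  -- The terms with `φ` cancel: `(XY)' = Y² + P X²`. Thus `XY` is monotone, and as a product of two
  -- `L²` functions it is integrable, hence zero; then `∫ c X² ≤ 0` on every interval. No boundary
  -- terms at infinity arise.
  have hd : ∀ᵐ s, c * X s ^ 2 ≤ deriv (X * Y) s := by
    filter_upwards [hX, hY, pX.ae_hasDerivAt, pY.ae_hasDerivAt] with s h1 h2 h3 h4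
    rw [(h3.mul h4).deriv, h1, h2]
    nlinarith [mul_nonneg (sub_nonneg.mpr (hP s)) (sq_nonneg (X s)), sq_nonneg (Y s)]
  have hint : ∀ a b, a ≤ b → ∫ s in a..b, c * X s ^ 2 ≤ (X * Y) b - (X * Y) a := by
    intro a b hab
    rw [← (hXY a b).integral_deriv_eq_sub]
    refine intervalIntegral.integral_mono_ae hab ?_ (hXY a b).intervalIntegrable_deriv hd
    exact (continuous_const.mul (pX.continuous.pow 2)).intervalIntegrable _ _
  have hmono : Monotone (X * Y) := fun a b hab => by
    have h1 := hint a b hab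
    have h2 : 0 ≤ ∫ s in a..b, c * X s ^ 2 :=
      intervalIntegral.integral_nonneg hab fun s _ => by positivity
    linarith
  have hzero := hmono.eq_zero_of_integrable
    ((hx.integrable_mul hy).congr (hX.mul hY))
  have hX0 : X = 0 := by
    by_contra hne
    obtain ⟨s, hs⟩ := Function.ne_iff.mp hne
    have hcont : Continuous fun s => c * X s ^ 2 := continuous_const.mul (pX.continuous.pow 2)
    have := intervalIntegral.integral_pos (a := s - 1) (b := s + 1) (by linarith)
      hcont.continuousOn (fun s _ => by positivity)
      ⟨s, ⟨by linarith, by linarith⟩, by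
        have : 0 < X s ^ 2 := sq_pos_of_ne_zero hs
        positivity⟩
    have h1 := hint (s - 1) (s + 1) (by linarith)
    rw [hzero] at h1
    simp only [Pi.zero_apply, sub_zero] at h1
    linarith
  rw [hX0] at hX
  exact hX

/-! ### Multiplication operators -/

/-- Bounded measurable real functions on the line. -/
structure IsMultiplier (m : ℝ → ℝ) : Prop where
  measurable : Measurable m
  bounded : ∃ C, ∀ s, |m s| ≤ C

theorem IsMultiplier.of_test {ψ : ℝ → ℝ} (hψ : Continuous ψ) (hc : HasCompactSupport ψ) :
    IsMultiplier ψ :=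
  ⟨hψ.measurable, hc.exists_bound_of_continuous hψ⟩

theorem IsMultiplier.memLp {m : ℝ → ℝ} (hm : IsMultiplier m) (u : L2) :
    MemLp (fun s => (m s : ℂ) * u s) 2 volume := by
  obtain ⟨C, hC⟩ := hm.bounded
  refine (Lp.memLp u).of_le_mul (c := C)
    ((Complex.measurable_ofReal.comp hm.measurable).aestronglyMeasurable.mul
      (Lp.aestronglyMeasurable u)) (ae_of_all _ fun s => ?_)
  rw [norm_mul, Complex.norm_real]
  exact mul_le_mul_of_nonneg_right (hC s) (norm_nonneg _)

theorem IsMultiplier.norm_toLp_le {m : ℝ → ℝ} (hm : IsMultiplier m) {C : ℝ}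
    (hC : ∀ s, |m s| ≤ C) (u : L2) : ‖(hm.memLp u).toLp _‖ ≤ C * ‖u‖ := by
  refine Lp.norm_le_mul_norm_of_ae_le_mul ?_
  filter_upwards [(hm.memLp u).coeFn_toLp] with s hs
  rw [hs, norm_mul, Complex.norm_real]
  exact mul_le_mul_of_nonneg_right (hC s) (norm_nonneg _)

/-- Multiplication by a bounded measurable real function as an operator in `L²(ℝ)`. -/
def mulOp (m : ℝ → ℝ) (hm : IsMultiplier m) : L2 →L[ℂ] L2 :=
  LinearMap.mkContinuous
    { toFun := fun u => (hm.memLp u).toLp _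
      map_add' := by
        intro u v
        refine Lp.ext ?_
        filter_upwards [(hm.memLp (u + v)).coeFn_toLp, (hm.memLp u).coeFn_toLp,
          (hm.memLp v).coeFn_toLp, Lp.coeFn_add u v,
          Lp.coeFn_add ((hm.memLp u).toLp _) ((hm.memLp v).toLp _)] with s a b c d e
        rw [a, e, Pi.add_apply, b, c, d, Pi.add_apply, mul_add]
      map_smul' := by
        intro z u
        refine Lp.ext ?_
        filter_upwards [(hm.memLp (z • u)).coeFn_toLp, (hm.memLp u).coeFn_toLp,
          Lp.coeFn_smul z u, Lp.coeFn_smul z ((hm.memLp u).toLp _)] with s a b c d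
        rw [RingHom.id_apply, a, d, Pi.smul_apply, b, c, Pi.smul_apply, smul_eq_mul, smul_eq_mul,
          mul_left_comm] }
    hm.bounded.choose (hm.norm_toLp_le hm.bounded.choose_spec)

theorem mulOp_coeFn {m : ℝ → ℝ} (hm : IsMultiplier m) (u : L2) :
    mulOp m hm u =ᵐ[volume] fun s => (m s : ℂ) * u s :=
  (hm.memLp u).coeFn_toLp

theorem norm_mulOp_le {m : ℝ → ℝ} (hm : IsMultiplier m) {C : ℝ} (hC : ∀ s, |m s| ≤ C) (u : L2) :
    ‖mulOp m hm u‖ ≤ C * ‖u‖ :=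
  hm.norm_toLp_le hC u

theorem inner_mulOp_eq_integral {m : ℝ → ℝ} (hm : IsMultiplier m) (u v : L2) :
    inner ℂ u (mulOp m hm v) = ∫ s, (m s : ℂ) * inner ℂ (u s) (v s) := by
  rw [L2.inner_def]
  refine integral_congr_ae ?_
  filter_upwards [mulOp_coeFn hm v] with s hs
  rw [hs, RCLike.inner_apply, RCLike.inner_apply]
  ring

theorem inner_mulOp_comm {m : ℝ → ℝ} (hm : IsMultiplier m) (u v : L2) :
    inner ℂ (mulOp m hm u) v = inner ℂ u (mulOp m hm v) := by
  rw [inner_mulOp_eq_integral, L2.inner_def]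
  refine integral_congr_ae ?_
  filter_upwards [mulOp_coeFn hm u] with s hs
  rw [hs, RCLike.inner_apply, RCLike.inner_apply, map_mul, Complex.conj_ofReal]
  ring

/-! ### Square integrable real functions as elements of `L²(ℝ)` -/

/-- The element of `L²(ℝ)` given by a square integrable real function. -/
def toL2 (f : ℝ → ℝ) (hf : MemLp f 2 volume) : L2 := hf.ofReal.toLp _

theorem toL2_coeFn {f : ℝ → ℝ} (hf : MemLp f 2 volume) :
    toL2 f hf =ᵐ[volume] fun s => (f s : ℂ) :=
  hf.ofReal.coeFn_toLp

theorem inner_toL2 {f : ℝ → ℝ} (hf : MemLp f 2 volume) (u : L2) :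
    inner ℂ (toL2 f hf) u = ∫ s, f s • u s := by
  rw [L2.inner_def]
  refine integral_congr_ae ?_
  filter_upwards [toL2_coeFn hf] with s hs
  rw [hs, RCLike.inner_apply, Complex.conj_ofReal, Complex.real_smul, mul_comm]

theorem integrable_smul_L2 {f : ℝ → ℝ} (hf : MemLp f 2 volume) (u : L2) :
    Integrable (fun s => f s • u s) := by
  have := MemLp.integrable_mul (p := 2) (q := 2) hf.ofReal (Lp.memLp u) (𝕜 := ℂ)
  exact this.congr (ae_of_all _ fun s => by simp)

theorem memLp_mul_test {m ψ : ℝ → ℝ} (hm : Measurable m)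
    (hb : ∀ R, ∃ C, ∀ s, |s| ≤ R → |m s| ≤ C) (hψ : Continuous ψ) (hc : HasCompactSupport ψ) :
    MemLp (fun s => m s * ψ s) 2 volume := by
  obtain ⟨R, hR⟩ := hc.isCompact.isBounded.subset_closedBall 0
  obtain ⟨C, hC⟩ := hb R
  refine (hψ.memLp_of_hasCompactSupport (p := 2) (μ := volume) hc).of_le_mul (c := C)
    (hm.aestronglyMeasurable.mul hψ.aestronglyMeasurable) (ae_of_all _ fun s => ?_)
  rw [norm_mul, Real.norm_eq_abs]
  by_cases hs : s ∈ tsupport ψ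
  · exact mul_le_mul_of_nonneg_right (hC s (by simpa using hR hs)) (norm_nonneg _)
  · simp [image_eq_zero_of_notMem_tsupport hs]

theorem memLp_test {ψ : ℝ → ℝ} (hψ : Continuous ψ) (hc : HasCompactSupport ψ) :
    MemLp ψ 2 volume := hψ.memLp_of_hasCompactSupport hc

/-! ### The form domain -/

/-- The data of the quadratic form `‖u' + φ u‖² + ‖√P u‖²`. -/
structure IsFormData (φ P : ℝ → ℝ) (c : ℝ) : Prop where
  smooth : ContDiff ℝ ∞ φ
  bounded : ∃ C, ∀ s, |φ s| ≤ C
  measurable : Measurable P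
  pos : 0 < c
  le : ∀ s, c ≤ P s

/-- `u` belongs to the domain of the form, with `v = u' + φ u` and `w = √P u`. -/
def InForm (φ P : ℝ → ℝ) (u v w : L2) : Prop :=
  w =ᵐ[volume] (fun s => (√(P s) : ℂ) * u s) ∧
    HasWeakDeriv u (fun s => v s - (φ s : ℂ) * u s)

/-- `A` is the bounded inverse of the operator associated with the form
`‖u' + φ u‖² + ‖√P u‖²`. -/
structure IsFormInverse (φ P : ℝ → ℝ) (c : ℝ) (A : L2 →L[ℂ] L2) : Prop where
  symm : ∀ f g, inner ℂ (A f) g = inner ℂ f (A g)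
  weak : ∀ f, ∃ v w, InForm φ P (A f) v w ∧ ‖v‖ ≤ (√c)⁻¹ * ‖f‖ ∧ ‖w‖ ≤ (√c)⁻¹ * ‖f‖ ∧
    ∀ u' v' w', InForm φ P u' v' w' → inner ℂ v' v + inner ℂ w' w = inner ℂ u' f

theorem _root_.MeasureTheory.Lp.locallyIntegrable_two (u : L2) : LocallyIntegrable u :=
  (Lp.memLp u).locallyIntegrable (by norm_num)

variable {φ P P' : ℝ → ℝ} {c : ℝ}

theorem IsFormData.isMultiplier (H : IsFormData φ P c) : IsMultiplier φ :=
  ⟨H.smooth.continuous.measurable, H.bounded⟩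

theorem IsFormData.abs_inv_sqrt_le (H : IsFormData φ P c) (s : ℝ) : |(√(P s))⁻¹| ≤ (√c)⁻¹ := by
  rw [abs_of_nonneg (by positivity)]
  exact inv_anti₀ (Real.sqrt_pos.mpr H.pos) (Real.sqrt_le_sqrt (H.le s))

theorem IsFormData.isMultiplier_inv_sqrt (H : IsFormData φ P c) :
    IsMultiplier fun s => (√(P s))⁻¹ :=
  ⟨H.measurable.sqrt.inv, _, H.abs_inv_sqrt_le⟩

/-- The Hilbert space of pairs of square integrable functions. -/
abbrev L2Pair : Type := WithLp 2 (L2 × L2)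

/-- The map `(v, w) ↦ w / √P`. -/
def pairFun (H : IsFormData φ P c) : L2Pair →L[ℂ] L2 :=
  (mulOp _ H.isMultiplier_inv_sqrt).comp (WithLp.sndL 2 ℂ L2 L2)

/-- The functional `(v, w) ↦ ∫ ψ' u + ∫ ψ (v - φ u)`, where `u = w / √P`. -/
def testFunctional (H : IsFormData φ P c) (ψ : {ψ : ℝ → ℝ // ContDiff ℝ ∞ ψ ∧ HasCompactSupport ψ}) :
    L2Pair →L[ℂ] ℂ :=
  (innerSL ℂ (toL2 _ (memLp_test (ψ.2.1.continuous_deriv (by simp)) ψ.2.2.deriv))).comp (pairFun H)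
    + (innerSL ℂ (toL2 _ (memLp_test ψ.2.1.continuous ψ.2.2))).comp
      (WithLp.fstL 2 ℂ L2 L2 - (mulOp φ H.isMultiplier).comp (pairFun H))

/-- The form domain, as a closed subspace of `L²(ℝ) × L²(ℝ)` via `u ↦ (u' + φ u, √P u)`. -/
def formSpace (H : IsFormData φ P c) : Submodule ℂ L2Pair :=
  ⨅ ψ, (testFunctional H ψ).ker

/-- Weak differentiability is expressed by bounded functionals of `(v, w)`, so the form domain is an
intersection of closed kernels. -/
instance (H : IsFormData φ P c) : CompleteSpace (formSpace H) := by
  have : IsClosed (formSpace H : Set L2Pair) := by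
    rw [formSpace, Submodule.coe_iInf]
    exact isClosed_iInter fun ψ => (testFunctional H ψ).isClosed_ker
  exact this.completeSpace_coe

theorem mem_formSpace_iff (H : IsFormData φ P c) (x : L2Pair) :
    x ∈ formSpace H ↔
      HasWeakDeriv (pairFun H x) (fun s => x.fst s - (φ s : ℂ) * pairFun H x s) := by
  have hae : x.fst - mulOp φ H.isMultiplier (pairFun H x) =ᵐ[volume]
      fun s => x.fst s - (φ s : ℂ) * pairFun H x s := by
    filter_upwards [Lp.coeFn_sub x.fst (mulOp φ H.isMultiplier (pairFun H x)),
      mulOp_coeFn H.isMultiplier (pairFun H x)] with s a b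
    rw [a, Pi.sub_apply, b]
  have hval : ∀ ψ, testFunctional H ψ x = (∫ s, deriv ψ.1 s • pairFun H x s)
      + ∫ s, ψ.1 s • (x.fst s - (φ s : ℂ) * pairFun H x s) := by
    intro ψ
    have e : ∫ s, ψ.1 s • (x.fst s - (φ s : ℂ) * pairFun H x s)
        = ∫ s, ψ.1 s • (x.fst - mulOp φ H.isMultiplier (pairFun H x)) s := by
      refine integral_congr_ae ?_
      filter_upwards [hae] with s hs
      rw [hs]
    rw [e, ← inner_toL2 (memLp_test ψ.2.1.continuous ψ.2.2),
      ← inner_toL2 (memLp_test (ψ.2.1.continuous_deriv (by simp)) ψ.2.2.deriv)]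
    rfl
  rw [formSpace, Submodule.mem_iInf]
  constructor
  · intro h
    refine ⟨Lp.locallyIntegrable_two _, (Lp.locallyIntegrable_two _).congr hae, fun ψ h1 h2 => ?_⟩
    have := h ⟨ψ, h1, h2⟩
    rw [LinearMap.mem_ker] at this
    exact eq_neg_of_add_eq_zero_left ((hval ⟨ψ, h1, h2⟩).symm.trans this)
  · intro h ψ
    rw [LinearMap.mem_ker]
    refine (hval ψ).trans ?_
    rw [h.2.2 ψ.1 ψ.2.1 ψ.2.2, neg_add_cancel]

theorem pairFun_coeFn (H : IsFormData φ P c) (x : L2Pair) :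
    x.snd =ᵐ[volume] fun s => (√(P s) : ℂ) * pairFun H x s := by
  filter_upwards [mulOp_coeFn H.isMultiplier_inv_sqrt x.snd] with s hs
  have : pairFun H x s = _ := hs
  have h0 : (√(P s) : ℂ) ≠ 0 :=
    Complex.ofReal_ne_zero.mpr (Real.sqrt_pos.mpr (H.pos.trans_le (H.le s))).ne'
  rw [this, Complex.ofReal_inv, mul_inv_cancel_left₀ h0]

theorem InForm.exists_mem (H : IsFormData φ P c) {u v w : L2} (h : InForm φ P u v w) :
    WithLp.toLp 2 (v, w) ∈ formSpace H ∧ pairFun H (WithLp.toLp 2 (v, w)) = u := by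
  have e : pairFun H (WithLp.toLp 2 (v, w)) = u := by
    refine Lp.ext ?_
    filter_upwards [h.1, mulOp_coeFn H.isMultiplier_inv_sqrt w] with s h1 h2
    have : pairFun H (WithLp.toLp 2 (v, w)) s = _ := h2
    have h0 : (√(P s) : ℂ) ≠ 0 :=
      Complex.ofReal_ne_zero.mpr (Real.sqrt_pos.mpr (H.pos.trans_le (H.le s))).ne'
    rw [this, h1, Complex.ofReal_inv, inv_mul_cancel_left₀ h0]
  refine ⟨?_, e⟩
  rw [mem_formSpace_iff, e]
  exact h.2

/-- The operator associated with the form `‖u' + φ u‖² + ‖√P u‖²` has a bounded inverse. -/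
theorem IsFormData.exists_isFormInverse (H : IsFormData φ P c) : ∃ A, IsFormInverse φ P c A := by
  -- For `q = ι* f` one has `⟨x, q⟩ = ⟨ι x, f⟩` for all `x` in the form space, which is the weak
  -- equation for `ι q`. So `ι ι*` is the solution operator, and it is visibly symmetric. The bound
  -- `‖ι‖ ≤ 1/√c` comes from `P ≥ c`.
  set ι : formSpace H →L[ℂ] L2 := (pairFun H).comp (formSpace H).subtypeL
  have hsq : ∀ x : L2Pair, ‖x‖ ^ 2 = ‖x.fst‖ ^ 2 + ‖x.snd‖ ^ 2 := fun x =>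
    WithLp.prod_norm_sq_eq_of_L2 x
  have hc : 0 ≤ (√c)⁻¹ := by positivity
  have hι : ‖ι‖ ≤ (√c)⁻¹ := by
    refine ι.opNorm_le_bound hc fun x => ?_
    refine (norm_mulOp_le H.isMultiplier_inv_sqrt H.abs_inv_sqrt_le _).trans ?_
    refine mul_le_mul_of_nonneg_left ?_ hc
    change ‖(x : L2Pair).snd‖ ≤ ‖(x : L2Pair)‖
    exact abs_le_of_sq_le_sq' (by nlinarith [hsq (x : L2Pair), sq_nonneg ‖(x : L2Pair).fst‖])
      (norm_nonneg _) |>.2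
  have hb : ∀ f, ‖(ContinuousLinearMap.adjoint ι f : L2Pair)‖ ≤ (√c)⁻¹ * ‖f‖ := fun f => by
    refine ((ContinuousLinearMap.adjoint ι).le_opNorm f).trans ?_
    rw [LinearIsometryEquiv.norm_map]
    exact mul_le_mul_of_nonneg_right hι (norm_nonneg _)
  refine ⟨ι.comp (ContinuousLinearMap.adjoint ι), ?_, ?_⟩
  · intro f g
    simp only [ContinuousLinearMap.comp_apply]
    exact (ContinuousLinearMap.adjoint_inner_right ι _ g).symm.trans
      (ContinuousLinearMap.adjoint_inner_left ι _ f)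
  · intro f
    set q := ContinuousLinearMap.adjoint ι f
    refine ⟨(q : L2Pair).fst, (q : L2Pair).snd, ⟨pairFun_coeFn H q, ?_⟩, ?_, ?_, ?_⟩
    · exact (mem_formSpace_iff H q).mp q.2
    · refine le_trans ?_ (hb f)
      exact abs_le_of_sq_le_sq' (by nlinarith [hsq (q : L2Pair), sq_nonneg ‖(q : L2Pair).snd‖])
        (norm_nonneg _) |>.2
    · refine le_trans ?_ (hb f)
      exact abs_le_of_sq_le_sq' (by nlinarith [hsq (q : L2Pair), sq_nonneg ‖(q : L2Pair).fst‖])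
        (norm_nonneg _) |>.2
    · intro u' v' w' h
      obtain ⟨hm, he⟩ := h.exists_mem H
      have := ContinuousLinearMap.adjoint_inner_right ι ⟨_, hm⟩ f
      rw [Submodule.coe_inner, WithLp.prod_inner_apply] at this
      rw [← he]
      exact this

/-! ### The inverse of the Schrödinger operator -/

/-- Boundedness on bounded intervals. -/
def IsLocallyBounded (m : ℝ → ℝ) : Prop := ∀ R, ∃ C, ∀ s, |s| ≤ R → |m s| ≤ C

theorem _root_.Continuous.isLocallyBounded {m : ℝ → ℝ} (hm : Continuous m) :
    IsLocallyBounded m := by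
  intro R
  obtain ⟨C, hC⟩ := (isCompact_Icc (a := -R) (b := R)).exists_bound_of_continuousOn hm.continuousOn
  exact ⟨C, fun s hs => hC s (abs_le.mp hs)⟩

theorem IsLocallyBounded.add {m n : ℝ → ℝ} (hm : IsLocallyBounded m) (hn : IsLocallyBounded n) :
    IsLocallyBounded fun s => m s + n s := by
  intro R
  obtain ⟨C, hC⟩ := hm R
  obtain ⟨D, hD⟩ := hn R
  exact ⟨C + D, fun s hs => (abs_add_le _ _).trans (add_le_add (hC s hs) (hD s hs))⟩

theorem IsLocallyBounded.mul {m n : ℝ → ℝ} (hm : IsLocallyBounded m) (hn : IsLocallyBounded n) :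
    IsLocallyBounded fun s => m s * n s := by
  intro R
  obtain ⟨C, hC⟩ := hm R
  obtain ⟨D, hD⟩ := hn R
  refine ⟨C * D, fun s hs => ?_⟩
  rw [abs_mul]
  exact mul_le_mul (hC s hs) (hD s hs) (abs_nonneg _) ((abs_nonneg _).trans (hC s hs))

theorem IsLocallyBounded.sqrt {m : ℝ → ℝ} (hm : IsLocallyBounded m) :
    IsLocallyBounded fun s => √(m s) := by
  intro R
  obtain ⟨C, hC⟩ := hm R
  refine ⟨√C, fun s hs => ?_⟩
  rw [abs_of_nonneg (Real.sqrt_nonneg _)]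
  exact Real.sqrt_le_sqrt ((le_abs_self _).trans (hC s hs))

theorem IsLocallyBounded.isMultiplier {m χ : ℝ → ℝ} (hm : IsLocallyBounded m)
    (hmm : Measurable m) (hχ : Continuous χ) (hc : HasCompactSupport χ) :
    IsMultiplier fun s => m s * χ s := by
  refine ⟨hmm.mul hχ.measurable, ?_⟩
  obtain ⟨R, hR⟩ := hc.isCompact.isBounded.subset_closedBall 0
  obtain ⟨C, hC⟩ := hm R
  obtain ⟨D, hD⟩ := hc.exists_bound_of_continuous hχ
  refine ⟨|C| * D, fun s => ?_⟩
  rw [abs_mul]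
  by_cases hs : s ∈ tsupport χ
  · exact mul_le_mul ((hC s (by simpa using hR hs)).trans (le_abs_self C)) (hD s) (abs_nonneg _)
      (abs_nonneg _)
  · rw [image_eq_zero_of_notMem_tsupport hs, abs_zero, mul_zero]
    exact mul_nonneg (abs_nonneg _) ((norm_nonneg _).trans (hD 0))

theorem _root_.MeasureTheory.LocallyIntegrable.isLocallyBounded_mul {m : ℝ → ℝ} {u : ℝ → ℂ}
    (hu : LocallyIntegrable u) (hm : IsLocallyBounded m) (hmm : Measurable m) :
    LocallyIntegrable fun s => (m s : ℂ) * u s := by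
  rw [locallyIntegrable_iff] at hu ⊢
  intro K hK
  obtain ⟨R, hR⟩ := hK.isBounded.subset_closedBall 0
  obtain ⟨C, hC⟩ := hm R
  refine (hu K hK).bdd_mul (c := C) (Complex.measurable_ofReal.comp hmm).aestronglyMeasurable ?_
  refine (ae_restrict_iff' hK.measurableSet).mpr (ae_of_all _ fun s hs => ?_)
  rw [Complex.norm_real]
  exact hC s (by simpa using hR hs)

theorem inForm_test {ψ : ℝ → ℝ}
    (hψ : ContDiff ℝ ∞ ψ) (hc : HasCompactSupport ψ)
    (h₁ : MemLp (fun s => deriv ψ s + φ s * ψ s) 2 volume)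
    (h₂ : MemLp (fun s => √(P s) * ψ s) 2 volume) :
    InForm φ P (toL2 ψ (memLp_test hψ.continuous hc)) (toL2 _ h₁) (toL2 _ h₂) := by
  have hψ' : ContDiff ℝ 1 fun s => (ψ s : ℂ) :=
    (Complex.ofRealCLM.contDiff.comp hψ).of_le (by simp)
  refine ⟨?_, (hasWeakDeriv_of_contDiff hψ').congr_smul 1 ?_ ?_⟩
  · filter_upwards [toL2_coeFn h₂, toL2_coeFn (memLp_test hψ.continuous hc)] with s a b
    rw [a, b, Complex.ofReal_mul]
  · filter_upwards [toL2_coeFn (memLp_test hψ.continuous hc)] with s b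
    simpa using b
  · filter_upwards [toL2_coeFn h₁, toL2_coeFn (memLp_test hψ.continuous hc)] with s a b
    rw [a, b, Pi.smul_apply, one_smul,
      ((hψ.differentiable (by simp) s).hasDerivAt.ofReal_comp).deriv]
    push_cast
    ring

/-- Real test functions lie in the form domain because `P` is locally bounded. Testing with them
gives `-v' + φv + Pu = f` in the sense of distributions, and `v = u' + φu` turns this into `-u'' +
(P - φ' + φ²)u = f`. -/
theorem IsFormInverse.mem_graph {A : L2 →L[ℂ] L2} (hA : IsFormInverse φ P c A)
    (H : IsFormData φ P c) (hP : IsLocallyBounded P) (f : L2) :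
    (A f, f) ∈ schrodingerGraph fun s => P s - deriv φ s + φ s ^ 2 := by
  obtain ⟨v, w, ⟨hw, hu⟩, -, -, hweak⟩ := hA.weak f
  set u := A f
  have hφ' : ContDiff ℝ ∞ (deriv φ) := H.smooth.deriv'
  have hVm : Measurable fun s => P s - deriv φ s + φ s ^ 2 :=
    (H.measurable.sub hφ'.continuous.measurable).add (H.smooth.continuous.measurable.pow_const 2)
  have hVb : IsLocallyBounded fun s => P s - deriv φ s + φ s ^ 2 := by
    simp only [sub_eq_add_neg]
    exact (hP.add hφ'.continuous.neg.isLocallyBounded).add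
      (H.smooth.continuous.pow 2).isLocallyBounded
  refine ⟨fun s => v s - (φ s : ℂ) * u s,
    fun s => ((P s - deriv φ s + φ s ^ 2 : ℝ) : ℂ) * u s - f s, hu, ?_, ⟨hu.2.1, ?_, ?_⟩, ?_⟩
  · exact (Lp.memLp v).sub (H.isMultiplier.memLp u)
  · exact ((Lp.locallyIntegrable_two u).isLocallyBounded_mul hVb hVm).sub
      (Lp.locallyIntegrable_two f)
  · intro ψ hψ hc
    have hψd := hψ.continuous_deriv (by simp)
    have hφc := H.smooth.continuous
    have m₁ : MemLp (deriv ψ) 2 volume := memLp_test hψd hc.deriv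
    have m₂ : MemLp (fun s => φ s * ψ s) 2 volume := memLp_test (hφc.mul hψ.continuous) hc.mul_left
    have m₃ : MemLp (fun s => φ s * deriv ψ s) 2 volume :=
      memLp_test (hφc.mul hψd) hc.deriv.mul_left
    have m₄ : MemLp (fun s => deriv φ s * ψ s) 2 volume :=
      memLp_test (hφ'.continuous.mul hψ.continuous) hc.mul_left
    have m₅ : MemLp (fun s => φ s ^ 2 * ψ s) 2 volume :=
      memLp_test ((hφc.pow 2).mul hψ.continuous) hc.mul_left
    have m₆ : MemLp (fun s => P s * ψ s) 2 volume := memLp_mul_test H.measurable hP hψ.continuous hc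
    have m₇ : MemLp (fun s => √(P s) * ψ s) 2 volume :=
      memLp_mul_test H.measurable.sqrt hP.sqrt hψ.continuous hc
    have m₈ : MemLp ψ 2 volume := memLp_test hψ.continuous hc
    have e₁ := hweak _ _ _ (inForm_test hψ hc (m₁.add m₂) m₇)
    rw [inner_toL2, inner_toL2, inner_toL2] at e₁
    -- The weak derivative of `u` tested against `φψ` eliminates `∫ φψ v` from `e₁`.
    have e₂ := hu.2.2 (fun s => φ s * ψ s) (H.smooth.mul hψ) hc.mul_left
    have hd : ∀ s, deriv (fun s => φ s * ψ s) s = deriv φ s * ψ s + φ s * deriv ψ s := fun s =>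
      deriv_fun_mul (H.smooth.differentiable (by simp) s) (hψ.differentiable (by simp) s)
    have e₃ : ∫ s, (√(P s) * ψ s) • w s = ∫ s, (P s * ψ s) • u s := by
      refine integral_congr_ae ?_
      filter_upwards [hw] with s hs
      have hsq : (P s : ℂ) = (√(P s) : ℂ) * √(P s) := by
        rw [← Complex.ofReal_mul, Real.mul_self_sqrt (H.pos.le.trans (H.le s))]
      rw [hs, Complex.real_smul, Complex.real_smul, Complex.ofReal_mul, Complex.ofReal_mul, hsq]
      ring
    rw [e₃] at e₁
    have i₁ := integrable_smul_L2 m₁ v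
    have i₂ := integrable_smul_L2 m₂ v
    have i₃ := integrable_smul_L2 m₃ u
    have i₄ := integrable_smul_L2 m₄ u
    have i₅ := integrable_smul_L2 m₅ u
    have i₆ := integrable_smul_L2 m₆ u
    have i₈ := integrable_smul_L2 m₈ f
    have a₁ : ∫ s, (deriv ψ s + φ s * ψ s) • v s
        = (∫ s, deriv ψ s • v s) + ∫ s, (φ s * ψ s) • v s := by
      rw [← integral_add i₁ i₂]
      simp only [add_smul]
    have a₂ : ∫ s, deriv (fun s => φ s * ψ s) s • u s
        = (∫ s, (deriv φ s * ψ s) • u s) + ∫ s, (φ s * deriv ψ s) • u s := by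
      rw [← integral_add i₄ i₃]
      simp only [hd, add_smul]
    have a₃ : ∫ s, (φ s * ψ s) • (v s - (φ s : ℂ) * u s)
        = (∫ s, (φ s * ψ s) • v s) - ∫ s, (φ s ^ 2 * ψ s) • u s := by
      rw [← integral_sub i₂ i₅]
      refine integral_congr_ae (ae_of_all _ fun s => ?_)
      simp only [Complex.real_smul]
      push_cast
      ring
    have a₄ : ∫ s, deriv ψ s • (v s - (φ s : ℂ) * u s)
        = (∫ s, deriv ψ s • v s) - ∫ s, (φ s * deriv ψ s) • u s := by
      rw [← integral_sub i₁ i₃]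
      refine integral_congr_ae (ae_of_all _ fun s => ?_)
      simp only [Complex.real_smul]
      push_cast
      ring
    have a₅ : ∫ s, ψ s • (((P s - deriv φ s + φ s ^ 2 : ℝ) : ℂ) * u s - f s)
        = (∫ s, (P s * ψ s) • u s) - (∫ s, (deriv φ s * ψ s) • u s)
          + (∫ s, (φ s ^ 2 * ψ s) • u s) - ∫ s, ψ s • f s := by
      have j₁ : Integrable fun s => (P s * ψ s) • u s - (deriv φ s * ψ s) • u s := i₆.sub i₄
      have j₂ : Integrable fun s => (P s * ψ s) • u s - (deriv φ s * ψ s) • u s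
        + (φ s ^ 2 * ψ s) • u s := j₁.add i₅
      rw [← integral_sub i₆ i₄, ← integral_add j₁ i₅, ← integral_sub j₂ i₈]
      refine integral_congr_ae (ae_of_all _ fun s => ?_)
      simp only [Complex.real_smul]
      push_cast
      ring
    rw [a₄, a₅]
    rw [a₁] at e₁
    rw [a₂, a₃] at e₂
    linear_combination e₁ - e₂
  · refine ae_of_all _ fun s => ?_
    simp only
    ring

/-- With `y = u' + φu` the equation factors into the first order system `u' = y - φu`, `y' = Pu +
φy`. -/
theorem eq_zero_of_mem_schrodingerGraph (H : IsFormData φ P c) {u : L2}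
    (hu : (u, (0 : L2)) ∈ schrodingerGraph fun s => P s - deriv φ s + φ s ^ 2) : u = 0 := by
  obtain ⟨u₁, u₂, h₁, hL, h₂, h⟩ := hu
  simp only at h₁ h
  have hv : HasWeakDeriv (fun s => u₁ s + (φ s : ℂ) * u s)
      (fun s => (P s : ℂ) * u s + (φ s : ℂ) * (u₁ s + (φ s : ℂ) * u s)) := by
    refine h₂.congr_add (h₁.smooth_smul H.smooth) (ae_of_all _ fun s => ?_) ?_
    · simp
    · filter_upwards [h, Lp.coeFn_zero ℂ 2 (volume : Measure ℝ)] with s a b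
      rw [b, Pi.zero_apply] at a
      simp only [Pi.add_apply, Complex.real_smul]
      push_cast at a ⊢
      linear_combination -a
  have hu : HasWeakDeriv u (fun s => (u₁ s + (φ s : ℂ) * u s) - (φ s : ℂ) * u s) := by
    simpa using h₁
  have key : ∀ L : ℂ →L[ℝ] ℝ, (fun s => L (u s)) =ᵐ[volume] 0 := by
    intro L
    have hmul : ∀ (r : ℝ) (z : ℂ), L ((r : ℂ) * z) = r * L z := fun r z => by
      rw [← Complex.real_smul, map_smul, smul_eq_mul]
    refine ae_zero_of_first_order_system (φ := φ) (P := P) H.pos H.le (L.comp_memLp' (Lp.memLp u))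
      (L.comp_memLp' (hL.add (H.isMultiplier.memLp u))) ?_ ?_
    · have := hu.clm_comp L
      simpa only [map_sub, hmul, Function.comp_def, Pi.add_apply] using this
    · have := hv.clm_comp L
      simpa only [map_add, hmul, Function.comp_def, Pi.add_apply] using this
  refine Lp.ext ?_
  filter_upwards [key Complex.reCLM, key Complex.imCLM, Lp.coeFn_zero ℂ 2 (volume : Measure ℝ)]
    with s a b z
  rw [z]
  exact Complex.ext a b

/-- The weak solution gives the right inverse. For the left inverse, `A(Tu) - u` lies in the kernel,
which is trivial. -/
theorem IsFormInverse.isBoundedInverse {A : L2 →L[ℂ] L2} (hA : IsFormInverse φ P c A)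
    (H : IsFormData φ P c) (hP : IsLocallyBounded P) :
    IsBoundedInverse (schrodinger fun s => P s - deriv φ s + φ s ^ 2) A := by
  constructor
  · intro f
    have := hA.mem_graph H hP f
    rw [← schrodinger_graph, LinearPMap.mem_graph_iff] at this
    obtain ⟨y, hy, hf⟩ := this
    simp only at hy hf
    refine ⟨hy ▸ y.2, ?_⟩
    exact (congrArg _ (Subtype.ext hy.symm)).trans hf
  · intro u
    have h₁ : ((u : L2), schrodinger _ u) ∈ schrodingerGraph fun s => P s - deriv φ s + φ s ^ 2 := by
      rw [← schrodinger_graph]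
      exact LinearPMap.mem_graph _ u
    have h₂ := Submodule.sub_mem _ (hA.mem_graph H hP (schrodinger _ u)) h₁
    rw [Prod.mk_sub_mk, sub_self] at h₂
    exact sub_eq_zero.mp (eq_zero_of_mem_schrodingerGraph H h₂)

/-! ### Convergence of the inverses -/

/-- Forms with different `P` may have different domains. A compactly supported cutoff carries
elements of one into the other, since `√P' χ` is bounded; the price is the commutator term `χ' u`.
-/
theorem InForm.cutoff {u v w : L2} (h : InForm φ P u v w) {χ : ℝ → ℝ} (hχ : ContDiff ℝ ∞ χ)
    (m₀ : IsMultiplier χ) (m₁ : IsMultiplier (deriv χ))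
    (m₂ : IsMultiplier fun s => √(P' s) * χ s) :
    InForm φ P' (mulOp χ m₀ u) (mulOp χ m₀ v + mulOp (deriv χ) m₁ u) (mulOp _ m₂ u) := by
  refine ⟨?_, (h.2.smooth_smul hχ).congr_smul 1 ?_ ?_⟩
  · filter_upwards [mulOp_coeFn m₂ u, mulOp_coeFn m₀ u] with s a b
    rw [a, b]
    push_cast
    ring
  · filter_upwards [mulOp_coeFn m₀ u] with s a
    rw [a, Pi.smul_apply, one_smul, Complex.real_smul]
  · filter_upwards [mulOp_coeFn m₀ u, mulOp_coeFn m₀ v, mulOp_coeFn m₁ u,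
      Lp.coeFn_add (mulOp χ m₀ v) (mulOp (deriv χ) m₁ u)] with s a b d e
    rw [e, Pi.add_apply, a, b, d, Pi.smul_apply, one_smul, Complex.real_smul, Complex.real_smul]
    ring

/-- Here `m u = (m/√P) w`: the potential term of the form controls `u` where `P` is large. -/
theorem InForm.norm_mulOp_le (H : IsFormData φ P c) {u v w : L2} (h : InForm φ P u v w)
    {m : ℝ → ℝ} (hm : IsMultiplier m) {κ : ℝ} (hκ : ∀ s, |m s * (√(P s))⁻¹| ≤ κ) :
    ‖mulOp m hm u‖ ≤ κ * ‖w‖ := by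
  refine Lp.norm_le_mul_norm_of_ae_le_mul ?_
  filter_upwards [mulOp_coeFn hm u, h.1] with s a b
  have hpos := Real.sqrt_pos.mpr (H.pos.trans_le (H.le s))
  rw [a, b, norm_mul, norm_mul, Complex.norm_real, Complex.norm_real, Real.norm_eq_abs,
    Real.norm_eq_abs, ← mul_assoc]
  refine mul_le_mul_of_nonneg_right ?_ (norm_nonneg _)
  have := hκ s
  rw [abs_mul, abs_inv] at this
  rwa [← div_le_iff₀ (abs_pos.mpr hpos.ne'), div_eq_mul_inv]

theorem InForm.norm_le (H : IsFormData φ P c) {u v w : L2} (h : InForm φ P u v w) :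
    ‖u‖ ≤ (√c)⁻¹ * ‖w‖ := by
  have h1 : IsMultiplier fun _ => 1 := ⟨measurable_const, 1, fun _ => by simp⟩
  have := h.norm_mulOp_le H h1 (κ := (√c)⁻¹) (fun s => by simpa using H.abs_inv_sqrt_le s)
  have e : mulOp _ h1 u = u := by
    refine Lp.ext ?_
    filter_upwards [mulOp_coeFn h1 u] with s a
    simpa using a
  rwa [e] at this

theorem InForm.inner_sqrt_mulOp {u v w z : L2} (h : InForm φ P u v w) (hP : ∀ s, 0 ≤ P s)
    {χ : ℝ → ℝ} (m₂ : IsMultiplier fun s => √(P s) * χ s) (m₃ : IsMultiplier fun s => P s * χ s) :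
    inner ℂ (mulOp _ m₂ z) w = inner ℂ z (mulOp _ m₃ u) := by
  rw [inner_mulOp_comm, inner_mulOp_eq_integral, inner_mulOp_eq_integral]
  refine integral_congr_ae ?_
  filter_upwards [h.1] with s hs
  have hsq : (P s : ℂ) = (√(P s) : ℂ) * √(P s) := by
    rw [← Complex.ofReal_mul, Real.mul_self_sqrt (hP s)]
  rw [hs, Complex.ofReal_mul, Complex.ofReal_mul, hsq, RCLike.inner_apply, RCLike.inner_apply]
  ring

/-- Put `u = A f` and `z = A' g`. Insert `χz` into the weak equation of `u` and `χu` into that of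
`z`, then subtract. The terms `⟨χ y, v⟩` cancel, leaving the tails with `1 - χ`, the commutators
with `χ'`, and `⟨z, (P - P')χu⟩`. Each is bounded through `‖v‖, ‖w‖ ≤ C‖f‖` and `‖u‖ ≤ C²‖f‖`, and
likewise for `z`, with `C = 1/√c`. -/
theorem IsFormInverse.norm_sub_le {A A' : L2 →L[ℂ] L2} (hA : IsFormInverse φ P c A)
    (hA' : IsFormInverse φ P' c A') (H : IsFormData φ P c) (H' : IsFormData φ P' c)
    (hP : IsLocallyBounded P) (hP' : IsLocallyBounded P') {χ : ℝ → ℝ} (hχ : ContDiff ℝ ∞ χ)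
    (hχc : HasCompactSupport χ) {κ δ δ' : ℝ} (hκ : ∀ s, |(1 - χ s) * (√(P s))⁻¹| ≤ κ)
    (hκ' : ∀ s, |(1 - χ s) * (√(P' s))⁻¹| ≤ κ) (hδ : ∀ s, |deriv χ s| ≤ δ)
    (hδ' : ∀ s, |(P s - P' s) * χ s| ≤ δ') :
    ‖A' - A‖ ≤ 2 * κ * (√c)⁻¹ + 2 * δ * (√c)⁻¹ ^ 3 + δ' * (√c)⁻¹ ^ 4 := by
  have hχd : Continuous (deriv χ) := hχ.continuous_deriv (by simp)
  have m₀ := IsMultiplier.of_test hχ.continuous hχc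
  have m₁ := IsMultiplier.of_test hχd hχc.deriv
  have mc : IsMultiplier fun s => 1 - χ s := by
    obtain ⟨C, hC⟩ := m₀.bounded
    exact ⟨measurable_const.sub m₀.measurable, 1 + C, fun s =>
      (abs_sub _ _).trans (by rw [abs_one]; exact add_le_add_right (hC s) 1)⟩
  have m₂ := hP.sqrt.isMultiplier H.measurable.sqrt hχ.continuous hχc
  have m₂' := hP'.sqrt.isMultiplier H'.measurable.sqrt hχ.continuous hχc
  have m₃ := hP.isMultiplier H.measurable hχ.continuous hχc
  have m₃' := hP'.isMultiplier H'.measurable hχ.continuous hχc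
  have m₄ : IsMultiplier fun s => (P s - P' s) * χ s :=
    ⟨(H.measurable.sub H'.measurable).mul hχ.continuous.measurable, δ', hδ'⟩
  set C := (√c)⁻¹
  have hC : 0 ≤ C := by positivity
  have hκ0 : 0 ≤ κ := (abs_nonneg _).trans (hκ 0)
  have hδ0 : 0 ≤ δ := (abs_nonneg _).trans (hδ 0)
  have hδ0' : 0 ≤ δ' := (abs_nonneg _).trans (hδ' 0)
  have hsplit : ∀ u : L2, mulOp _ mc u = u - mulOp χ m₀ u := fun u => by
    refine Lp.ext ?_
    filter_upwards [mulOp_coeFn mc u, mulOp_coeFn m₀ u, Lp.coeFn_sub u (mulOp χ m₀ u)] with s a b d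
    rw [d, Pi.sub_apply, a, b]
    push_cast
    ring
  have hdiff : ∀ u : L2, mulOp _ m₄ u = mulOp _ m₃ u - mulOp _ m₃' u := fun u => by
    refine Lp.ext ?_
    filter_upwards [mulOp_coeFn m₄ u, mulOp_coeFn m₃ u, mulOp_coeFn m₃' u,
      Lp.coeFn_sub (mulOp _ m₃ u) (mulOp _ m₃' u)] with s a b d e
    rw [e, Pi.sub_apply, a, b, d]
    push_cast
    ring
  set E := 2 * κ * C + 2 * δ * C ^ 3 + δ' * C ^ 4
  have hE : 0 ≤ E := by positivity
  have main : ∀ f g : L2, ‖inner ℂ g ((A' - A) f)‖ ≤ E * ‖f‖ * ‖g‖ := by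
    intro f g
    obtain ⟨v, w, hu, hv, hw, hweak⟩ := hA.weak f
    obtain ⟨y, x, hz, hy, hx, hweak'⟩ := hA'.weak g
    set u := A f
    set z := A' g
    have e₁ := hweak _ _ _ (hz.cutoff hχ m₀ m₁ m₂)
    have e₂ := congrArg (starRingEnd ℂ) (hweak' _ _ _ (hu.cutoff hχ m₀ m₁ m₂'))
    rw [map_add, inner_conj_symm, inner_conj_symm, inner_conj_symm] at e₂
    rw [hu.inner_sqrt_mulOp (fun s => H.pos.le.trans (H.le s)) m₂ m₃] at e₁
    have e₃ := congrArg (starRingEnd ℂ)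
      (hz.inner_sqrt_mulOp (z := u) (fun s => H'.pos.le.trans (H'.le s)) m₂' m₃')
    rw [inner_conj_symm, inner_conj_symm, inner_mulOp_comm] at e₃
    rw [e₃, inner_add_right] at e₂
    rw [inner_add_left] at e₁
    have e₄ := inner_mulOp_comm m₀ y v
    have e₅ : inner ℂ g ((A' - A) f) = inner ℂ (mulOp _ mc z) f - inner ℂ g (mulOp _ mc u)
        + inner ℂ (mulOp _ m₁ z) v - inner ℂ y (mulOp _ m₁ u) + inner ℂ z (mulOp _ m₄ u) := by
      rw [sub_apply, inner_sub_right, ← hA'.symm, hsplit, hsplit, hdiff,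
        inner_sub_left, inner_sub_right, inner_sub_right]
      linear_combination e₂ + e₄ - e₁
    have hun : ‖u‖ ≤ C ^ 2 * ‖f‖ := (hu.norm_le H).trans
      ((mul_le_mul_of_nonneg_left hw hC).trans_eq (by ring))
    have hzn : ‖z‖ ≤ C ^ 2 * ‖g‖ := (hz.norm_le H').trans
      ((mul_le_mul_of_nonneg_left hx hC).trans_eq (by ring))
    have b₁ : ‖inner ℂ (mulOp _ mc z) f‖ ≤ (κ * (C * ‖g‖)) * ‖f‖ :=
      (norm_inner_le_norm _ _).trans (mul_le_mul_of_nonneg_right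
        ((hz.norm_mulOp_le H' mc hκ').trans (mul_le_mul_of_nonneg_left hx hκ0)) (norm_nonneg _))
    have b₂ : ‖inner ℂ g (mulOp _ mc u)‖ ≤ ‖g‖ * (κ * (C * ‖f‖)) :=
      (norm_inner_le_norm _ _).trans (mul_le_mul_of_nonneg_left
        ((hu.norm_mulOp_le H mc hκ).trans (mul_le_mul_of_nonneg_left hw hκ0)) (norm_nonneg _))
    have b₃ : ‖inner ℂ (mulOp _ m₁ z) v‖ ≤ (δ * (C ^ 2 * ‖g‖)) * (C * ‖f‖) :=
      (norm_inner_le_norm _ _).trans (mul_le_mul ((DeformedTube.norm_mulOp_le m₁ hδ z).trans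
        (mul_le_mul_of_nonneg_left hzn hδ0)) hv (norm_nonneg _) (by positivity))
    have b₄ : ‖inner ℂ y (mulOp _ m₁ u)‖ ≤ (C * ‖g‖) * (δ * (C ^ 2 * ‖f‖)) :=
      (norm_inner_le_norm _ _).trans (mul_le_mul hy ((DeformedTube.norm_mulOp_le m₁ hδ u).trans
        (mul_le_mul_of_nonneg_left hun hδ0)) (norm_nonneg _) (by positivity))
    have b₅ : ‖inner ℂ z (mulOp _ m₄ u)‖ ≤ (C ^ 2 * ‖g‖) * (δ' * (C ^ 2 * ‖f‖)) :=
      (norm_inner_le_norm _ _).trans (mul_le_mul hzn ((DeformedTube.norm_mulOp_le m₄ hδ' u).trans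
        (mul_le_mul_of_nonneg_left hun hδ0')) (norm_nonneg _) (by positivity))
    rw [e₅]
    refine (norm_add_le _ _).trans ?_
    refine (add_le_add_left ((_root_.norm_sub_le _ _).trans (add_le_add_left ((norm_add_le _ _).trans
      (add_le_add_left (_root_.norm_sub_le _ _) _)) _)) _).trans ?_
    refine (add_le_add (add_le_add (add_le_add (add_le_add b₁ b₂) b₃) b₄) b₅).trans_eq ?_
    simp only [E]
    ring
  refine ContinuousLinearMap.opNorm_le_bound _ hE fun f => ?_
  -- Choosing `g = (A' - A) f` turns the bilinear bound into a norm bound.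
  have := main f ((A' - A) f)
  rw [inner_self_eq_norm_sq_to_K, norm_pow, RCLike.norm_ofReal, abs_norm, pow_two] at this
  rcases (norm_nonneg ((A' - A) f)).eq_or_lt with h0 | h0
  · rw [← h0]
    positivity
  · exact le_of_mul_le_mul_right this h0

/-- Dilating one fixed bump keeps `C` independent of `R`. -/
theorem exists_cutoff : ∃ C : ℝ, ∀ R : ℝ, 0 < R → ∃ χ : ℝ → ℝ, ContDiff ℝ ∞ χ ∧
    HasCompactSupport χ ∧ (∀ s, |s| ≤ R → χ s = 1) ∧ (∀ s, 2 * R ≤ |s| → χ s = 0) ∧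
    (∀ s, 0 ≤ χ s ∧ χ s ≤ 1) ∧ ∀ s, |deriv χ s| ≤ C / R := by
  let b : ContDiffBump (0 : ℝ) := ⟨1, 2, one_pos, one_lt_two⟩
  obtain ⟨C, hC⟩ := b.hasCompactSupport.deriv.exists_bound_of_continuous
    ((b.contDiff (n := 1)).continuous_deriv le_rfl)
  refine ⟨C, fun R hR => ⟨fun s => b (R⁻¹ * s), b.contDiff.comp (contDiff_const.mul contDiff_id),
    b.hasCompactSupport.comp_homeomorph (Homeomorph.mulLeft₀ R⁻¹ (inv_ne_zero hR.ne')),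
    fun s hs => b.one_of_mem_closedBall ?_, fun s hs => b.zero_of_le_dist ?_,
    fun s => ⟨b.nonneg, b.le_one⟩, fun s => ?_⟩⟩
  · rw [mem_closedBall_zero_iff, Real.norm_eq_abs, abs_mul, abs_inv, abs_of_pos hR]
    exact (inv_mul_le_iff₀ hR).mpr (by simpa [b] using hs)
  · rw [dist_zero_right, Real.norm_eq_abs, abs_mul, abs_inv, abs_of_pos hR]
    exact (le_inv_mul_iff₀ hR).mpr (by simpa [b, mul_comm] using hs)
  · rw [deriv_comp_mul_left, smul_eq_mul, abs_mul, abs_inv, abs_of_pos hR, div_eq_inv_mul]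
    exact mul_le_mul_of_nonneg_left (hC _) (by positivity)

/-- Norm convergence of the inverses if the potentials converge locally uniformly and are
uniformly confining. -/
theorem tendsto_norm_sub_isFormInverse {ι : Type*} {l : Filter ι} {Q : ι → ℝ → ℝ}
    {A : L2 →L[ℂ] L2} {B : ι → L2 →L[ℂ] L2} (hA : IsFormInverse φ P c A) (H : IsFormData φ P c)
    (hP : IsLocallyBounded P)
    (hQ : ∀ᶠ i in l, IsFormData φ (Q i) c ∧ IsLocallyBounded (Q i) ∧ IsFormInverse φ (Q i) c (B i))
    (hconv : ∀ R η, 0 < η → ∀ᶠ i in l, ∀ s, |s| ≤ R → |P s - Q i s| ≤ η)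
    (hconf : ∀ K, ∃ R, ∀ᶠ i in l, ∀ s, R ≤ |s| → K ≤ P s ∧ K ≤ Q i s) :
    Tendsto (fun i => ‖B i - A‖) l (𝓝 0) := by
  obtain ⟨D, hD⟩ := exists_cutoff
  set C := (√c)⁻¹
  have hC : 0 ≤ C := by positivity
  rw [Metric.tendsto_nhds]
  intro η hη
  set t := η / (4 * (1 + C + C ^ 3 + C ^ 4)) with ht
  have ht0 : 0 < t := by positivity
  -- The level `t⁻²` makes `1/√P ≤ t` outside `R₀`. Below, `R ≥ D/t` forces `|χ'| ≤ t`, so all three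
  -- errors are governed by `t`.
  obtain ⟨R₀, hR₀⟩ := hconf ((t⁻¹) ^ 2)
  set R := max (max R₀ 1) (D / t)
  have hR : 0 < R := lt_of_lt_of_le one_pos ((le_max_right _ _).trans (le_max_left _ _))
  obtain ⟨χ, hχ, hχc, hχ1, hχ0, hχb, hχd⟩ := hD R hR
  filter_upwards [hQ, hR₀, hconv (2 * R) t ht0] with i ⟨H', hQb, hB⟩ hK hcv
  have hκ : ∀ {p : ℝ → ℝ}, (∀ s, R₀ ≤ |s| → (t⁻¹) ^ 2 ≤ p s) →
      ∀ s, |(1 - χ s) * (√(p s))⁻¹| ≤ t := by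
    intro p hp s
    by_cases hs : |s| ≤ R
    · simp [hχ1 s hs, ht0.le]
    · have h1 := hp s (((le_max_left _ _).trans (le_max_left _ _)).trans (not_le.mp hs).le)
      have h2 : t⁻¹ ≤ √(p s) := Real.le_sqrt_of_sq_le h1
      have h3 : (√(p s))⁻¹ ≤ t := inv_le_of_inv_le₀ ht0 h2
      rw [abs_of_nonneg (mul_nonneg (by linarith [(hχb s).2]) (by positivity))]
      exact (mul_le_of_le_one_left (by positivity) (by linarith [(hχb s).1])).trans h3
  have key := hA.norm_sub_le hB H H' hP hQb hχ hχc (κ := t) (δ := t) (δ' := t)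
    (hκ fun s hs => (hK s hs).1) (hκ fun s hs => (hK s hs).2) (fun s => ?_) (fun s => ?_)
  · rw [dist_zero_right, norm_norm]
    refine key.trans_lt ?_
    have h4 : t * (4 * (1 + C + C ^ 3 + C ^ 4)) = η := by
      rw [ht]
      field_simp
    have : 0 ≤ t * C ^ 4 := by positivity
    have : 0 ≤ t * C ^ 3 := by positivity
    have : 0 ≤ t * C := by positivity
    nlinarith
  · refine (hχd s).trans ?_
    rw [div_le_iff₀ hR, ← div_le_iff₀' ht0]
    exact le_max_right _ _
  · by_cases hs : |s| ≤ 2 * R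
    · rw [abs_mul, abs_of_nonneg (hχb s).1]
      exact (mul_le_of_le_one_right (abs_nonneg _) (hχb s).2).trans (hcv s hs)
    · rw [hχ0 s (not_le.mp hs).le, mul_zero, abs_zero]
      exact ht0.le

/-! ### Rescaling -/

theorem dilation_symm {ε : ℝ} (hε : 0 < ε) : (dilation ε).symm = dilation ε⁻¹ := by
  refine LinearIsometryEquiv.ext fun u => ?_
  have h₁ : dilation ε⁻¹ u = dilationFun (inv_pos.mpr hε) u := by
    unfold dilation
    rw [dif_pos (inv_pos.mpr hε)]
    rfl
  have h₂ : (dilation ε).symm u = dilationFun (inv_pos.mpr hε) u := by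
    unfold dilation
    rw [dif_pos hε]
    rfl
  rw [h₁, h₂]

/-- Each derivative of `u(√ε s)` yields a factor `√ε`, so the second derivative carries exactly the
`ε` multiplying the operator. -/
theorem dilation_mem_schrodingerGraph {V : ℝ → ℝ} {u f : L2} (h : (u, f) ∈ schrodingerGraph V)
    {ε : ℝ} (hε : 0 < ε) :
    (dilation ε u, (ε : ℂ) • dilation ε f) ∈ schrodingerGraph fun s => ε * V (√ε * s) := by
  obtain ⟨u₁, u₂, h₁, hL, h₂, h₃⟩ := h
  have ha := Real.sqrt_pos.mpr hε
  have hsq : (ε : ℂ) = (√ε : ℂ) * √ε := by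
    rw [← Complex.ofReal_mul, Real.mul_self_sqrt hε.le]
  set e : ℂ := ((ε ^ (1 / 4 : ℝ) : ℝ) : ℂ)
  refine ⟨fun s => e * (√ε * u₁ (√ε * s)), fun s => e * (√ε * (√ε * u₂ (√ε * s))), ?_, ?_, ?_, ?_⟩
  · refine (h₁.comp_mul ha).congr_smul e ?_ (ae_of_all _ fun s => rfl)
    exact dilation_coeFn hε u
  · exact ((memLp_comp_mul ha hL).const_mul _).const_mul _
  · exact (h₂.comp_mul ha).congr_smul (e * √ε)
      (ae_of_all _ fun s => by simp [mul_assoc]) (ae_of_all _ fun s => by simp [mul_assoc])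
  · have h₄ := (quasiMeasurePreserving_mul ha).ae h₃
    filter_upwards [h₄, dilation_coeFn hε u, dilation_coeFn hε f,
      Lp.coeFn_smul (ε : ℂ) (dilation ε f)] with s a b d g
    rw [g, Pi.smul_apply, d, b, a, smul_eq_mul, Complex.ofReal_mul, hsq]
    ring

/-- Graphs are transported by the dilations with parameters `ε` and `ε⁻¹`, which handle the right
and left inverse respectively. -/
theorem IsBoundedInverse.rescaled {V : ℝ → ℝ} {A : L2 →L[ℂ] L2} {ε : ℝ} (hε : 0 < ε)
    (hA : IsBoundedInverse (schrodinger fun s => ε * V (√ε * s)) A) :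
    IsBoundedInverse (rescaled ε (schrodinger V)) A := by
  have hε' : (ε : ℂ) ≠ 0 := Complex.ofReal_ne_zero.mpr hε.ne'
  constructor
  · intro f
    obtain ⟨h, hf⟩ := hA.1 f
    have h₁ : (A f, f) ∈ schrodingerGraph fun s => ε * V (√ε * s) := by
      rw [← schrodinger_graph, LinearPMap.mem_graph_iff]
      exact ⟨⟨A f, h⟩, rfl, hf⟩
    have h₂ := dilation_mem_schrodingerGraph h₁ (inv_pos.mpr hε)
    have hV : (fun s => ε⁻¹ * (ε * V (√ε * (√ε⁻¹ * s)))) = V := by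
      funext s
      rw [inv_mul_cancel_left₀ hε.ne', Real.sqrt_inv,
        mul_inv_cancel_left₀ (Real.sqrt_pos.mpr hε).ne']
    rw [hV, ← schrodinger_graph, LinearPMap.mem_graph_iff, ← dilation_symm hε] at h₂
    obtain ⟨y, hy, hTy⟩ := h₂
    simp only at hy hTy
    have hmem : (dilation ε).symm (A f) ∈ (schrodinger V).domain := hy ▸ y.2
    refine ⟨hmem, ?_⟩
    change (ε : ℂ) • dilation ε (schrodinger V ⟨(dilation ε).symm (A f), hmem⟩) = f
    have : (⟨(dilation ε).symm (A f), hmem⟩ : (schrodinger V).domain) = y := Subtype.ext hy.symm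
    rw [this, hTy, map_smul, LinearIsometryEquiv.apply_symm_apply, Complex.ofReal_inv,
      smul_inv_smul₀ hε']
  · intro u
    have h₁ : ((dilation ε).symm (u : L2), schrodinger V ⟨(dilation ε).symm (u : L2), u.2⟩)
        ∈ schrodingerGraph V := by
      rw [← schrodinger_graph]
      exact LinearPMap.mem_graph _ ⟨(dilation ε).symm (u : L2), u.2⟩
    have h₂ := dilation_mem_schrodingerGraph h₁ hε
    rw [LinearIsometryEquiv.apply_symm_apply, ← schrodinger_graph, LinearPMap.mem_graph_iff] at h₂
    obtain ⟨y, hy, hTy⟩ := h₂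
    have := hA.2 y
    rw [hTy, hy] at this
    exact this

/-! ### Positivity of the ground state energy -/

/-- The Poincaré inequality for test functions on a bounded plane region. -/
theorem exists_poincare {S : Set E2} (hb : Bornology.IsBounded S) :
    ∃ C : ℝ≥0∞, C ≠ ⊤ ∧ ∀ φ : E2 → ℝ, IsTestFunction S φ →
      eLpNorm φ 2 (volume.restrict S) ≤ C * eLpNorm (∇ φ) 2 (volume.restrict S) := by
  have hfin : Module.finrank ℝ E2 = 2 := by simp [E2]
  have hv : volume S ≠ ⊤ := hb.measure_lt_top.ne
  refine ⟨eLpNormLESNormFDerivOfLeConst ℝ (volume : Measure E2) S 1 2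
    * (volume S) ^ (1 / (1 : ℝ≥0∞).toReal - 1 / (2 : ℝ≥0∞).toReal), ?_, ?_⟩
  · exact ENNReal.mul_ne_top ENNReal.coe_ne_top (ENNReal.rpow_ne_top_of_nonneg (by norm_num) hv)
  · intro φ hφ
    have h1 : ContDiff ℝ 1 φ := hφ.1.of_le (by simp)
    have hsup : Function.support φ ⊆ S := (subset_tsupport φ).trans hφ.2.2
    -- In dimension two the Sobolev exponent of `1` is `2`, so `‖φ‖₂ ≤ C‖Dφ‖₁`. Hölder on the
    -- bounded set `S` then passes from `L¹` to `L²`.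
    have key := eLpNorm_le_eLpNorm_fderiv_of_le (F := ℝ) (volume : Measure E2) h1 hsup
      (p := 1) (q := 2) le_rfl (by rw [hfin]; norm_num) (by rw [hfin]; norm_num) hb
    have hfd : Continuous (fderiv ℝ φ) := h1.continuous_fderiv one_ne_zero
    have hsd : Function.support (fderiv ℝ φ) ⊆ S := (support_fderiv_subset ℝ).trans hφ.2.2
    have e₁ : eLpNorm φ 2 (volume.restrict S) = eLpNorm φ 2 volume :=
      eLpNorm_restrict_eq_of_support_subset hsup
    have e₂ := eLpNorm_restrict_eq_of_support_subset (ε := E2 →L[ℝ] ℝ) (f := fderiv ℝ φ) (p := 1)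
      (μ := (volume : Measure E2)) hsd
    have e₃ : eLpNorm (∇ φ) 2 (volume.restrict S) = eLpNorm (fderiv ℝ φ) 2 (volume.restrict S) := by
      exact eLpNorm_congr_norm_ae (ae_of_all _ fun x =>
        (InnerProductSpace.toDual ℝ E2).symm.norm_map (fderiv ℝ φ x))
    have h2 := eLpNorm_le_eLpNorm_mul_rpow_measure_univ (μ := volume.restrict S) (p := 1) (q := 2)
      (by norm_num) hfd.aestronglyMeasurable
    rw [Measure.restrict_apply_univ] at h2
    rw [e₁, e₃, mul_assoc, mul_comm (_ ^ _)]
    refine key.trans (mul_le_mul_right ?_ _)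
    push_cast
    rw [← e₂]
    exact h2

/-- Testing the eigenvalue equation with test functions approximating `u₀` gives `λ₀ = ‖∇u₀‖²` in
the limit. The Poincaré inequality also passes to the limit, so `∇u₀ = 0` would contradict `‖u₀‖ =
1`. -/
theorem IsGroundState.lam0_pos {S : Set E2} (hS : IsCrossSection S) {lam0 : ℝ} {u0 : E2 → ℝ}
    {Du0 : E2 → E2} (h : IsGroundState S lam0 u0 Du0) : 0 < lam0 := by
  obtain ⟨⟨⟨hu, hg, φ, hφ, hφu, hφg⟩, hweak⟩, hnorm⟩ := And.intro h.solution h.normalized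
  obtain ⟨C, hC, hp⟩ := exists_poincare hS.isBounded
  set μ := (volume.restrict S : Measure E2)
  have hφL : ∀ n, MemLp (φ n) 2 μ := fun n =>
    ((hφ n).1.continuous.memLp_of_hasCompactSupport (hφ n).2.1).restrict S
  have hgc : ∀ n, Continuous (∇ (φ n)) := fun n =>
    (InnerProductSpace.toDual ℝ E2).symm.continuous.comp
      (((hφ n).1.of_le (by simp) : ContDiff ℝ 1 (φ n)).continuous_fderiv one_ne_zero)
  have hgs : ∀ n, HasCompactSupport (∇ (φ n)) := fun n =>
    (((hφ n).2.1.fderiv (𝕜 := ℝ)).comp_left (map_zero (InnerProductSpace.toDual ℝ E2).symm))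
  have hgL : ∀ n, MemLp (∇ (φ n)) 2 μ := fun n =>
    ((hgc n).memLp_of_hasCompactSupport (hgs n)).restrict S
  have real_inner_eq_mul : ∀ a b : ℝ, inner ℝ a b = a * b := fun a b => by simp [mul_comm]
  set U := hu.toLp u0
  set G := hg.toLp Du0
  have tU : Tendsto (fun n => (hφL n).toLp (φ n)) atTop (𝓝 U) :=
    (Lp.tendsto_Lp_iff_tendsto_eLpNorm'' _ hφL _ hu).mpr hφu
  have tG : Tendsto (fun n => (hgL n).toLp (∇ (φ n))) atTop (𝓝 G) :=
    (Lp.tendsto_Lp_iff_tendsto_eLpNorm'' _ hgL _ hg).mpr hφg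
  have hw : ∀ n, inner ℝ G ((hgL n).toLp (∇ (φ n))) = lam0 * inner ℝ U ((hφL n).toLp (φ n)) := by
    intro n
    rw [L2.inner_def, L2.inner_def]
    have a : ∫ y, inner ℝ (G y) ((hgL n).toLp (∇ (φ n)) y) ∂μ
        = ∫ y, inner ℝ (Du0 y) (∇ (φ n) y) ∂μ := by
      refine integral_congr_ae ?_
      filter_upwards [hg.coeFn_toLp, (hgL n).coeFn_toLp] with y h1 h2
      rw [h1, h2]
    have b : ∫ y, inner ℝ (U y) ((hφL n).toLp (φ n) y) ∂μ = ∫ y, u0 y * φ n y ∂μ := by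
      refine integral_congr_ae ?_
      filter_upwards [hu.coeFn_toLp, (hφL n).coeFn_toLp] with y h1 h2
      rw [h1, h2, real_inner_eq_mul]
    rw [a, b]
    exact hweak _ (hφ n)
  have hlim : inner ℝ G G = lam0 * inner ℝ U U :=
    tendsto_nhds_unique ((tendsto_const_nhds.inner tG).congr hw)
      ((tendsto_const_nhds.inner tU).const_mul _)
  have hU1 : ‖U‖ ^ 2 = 1 := by
    rw [← real_inner_self_eq_norm_sq, L2.inner_def, ← hnorm]
    refine integral_congr_ae ?_
    filter_upwards [hu.coeFn_toLp] with y h1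
    rw [h1, real_inner_eq_mul, sq]
  have hpn : ∀ n, ‖(hφL n).toLp (φ n)‖ ≤ C.toReal * ‖(hgL n).toLp (∇ (φ n))‖ := by
    intro n
    rw [Lp.norm_toLp, Lp.norm_toLp, ← ENNReal.toReal_mul]
    exact ENNReal.toReal_mono (ENNReal.mul_ne_top hC (hgL n).2.ne) (hp _ (hφ n))
  have hUG : ‖U‖ ≤ C.toReal * ‖G‖ :=
    le_of_tendsto_of_tendsto' tU.norm (tG.norm.const_mul _) hpn
  rw [real_inner_self_eq_norm_sq, real_inner_self_eq_norm_sq, hU1, mul_one] at hlim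
  rw [← hlim]
  refine pow_pos ((norm_nonneg G).lt_of_ne fun h0 => ?_) 2
  rw [← h0, mul_zero] at hUG
  rw [le_antisymm hUG (norm_nonneg U)] at hU1
  norm_num at hU1

/-! ### Families of potentials with a quadratic well -/

/-- The logarithmic derivative `s / (s² + ρ²)` used to bound Schrödinger operators from below. -/
def wellFun (ρ s : ℝ) : ℝ := s / (s ^ 2 + ρ ^ 2)

variable {ρ : ℝ}

theorem contDiff_wellFun (hρ : 0 < ρ) : ContDiff ℝ ∞ (wellFun ρ) :=
  contDiff_id.div ((contDiff_id.pow 2).add contDiff_const) fun s => by positivity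

theorem abs_wellFun_le (hρ : 0 < ρ) (s : ℝ) : |wellFun ρ s| ≤ ρ⁻¹ := by
  have h : 0 < s ^ 2 + ρ ^ 2 := by positivity
  rw [wellFun, abs_div, abs_of_pos h, div_le_iff₀ h, inv_mul_eq_div, le_div_iff₀ hρ]
  nlinarith [sq_abs s, sq_nonneg (|s| - ρ), abs_nonneg s]

theorem deriv_wellFun_sub_sq (hρ : 0 < ρ) (s : ℝ) :
    deriv (wellFun ρ) s - wellFun ρ s ^ 2 = (ρ ^ 2 - 2 * s ^ 2) / (s ^ 2 + ρ ^ 2) ^ 2 := by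
  have h : s ^ 2 + ρ ^ 2 ≠ 0 := by positivity
  have hd : HasDerivAt (wellFun ρ)
      ((1 * (s ^ 2 + ρ ^ 2) - s * (2 * s)) / (s ^ 2 + ρ ^ 2) ^ 2) s := by
    refine (hasDerivAt_id s).fun_div (?_ : HasDerivAt (fun s => s ^ 2 + ρ ^ 2) (2 * s) s) h
    simpa using (hasDerivAt_pow 2 s).add_const (ρ ^ 2)
  rw [hd.deriv, wellFun]
  field_simp
  ring

/-- The minimum is attained at `s² = 2ρ²`. -/
theorem neg_le_deriv_wellFun_sub_sq (hρ : 0 < ρ) (s : ℝ) :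
    -(1 / (3 * ρ ^ 2)) ≤ deriv (wellFun ρ) s - wellFun ρ s ^ 2 := by
  have h : 0 < (s ^ 2 + ρ ^ 2) ^ 2 := by positivity
  rw [deriv_wellFun_sub_sq hρ, le_div_iff₀ h, neg_mul, one_div_mul_eq_div, neg_le,
    le_div_iff₀ (by positivity)]
  nlinarith [sq_nonneg (s ^ 2 - 2 * ρ ^ 2)]

/-- The bound is the value at `s² = ρ²/4`: numerator `ρ²/2`, denominator `(5ρ²/4)²`. -/
theorem le_deriv_wellFun_sub_sq (hρ : 0 < ρ) {s : ℝ} (hs : s ^ 2 ≤ ρ ^ 2 / 4) :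
    8 / 25 / ρ ^ 2 ≤ deriv (wellFun ρ) s - wellFun ρ s ^ 2 := by
  have h : 0 < (s ^ 2 + ρ ^ 2) ^ 2 := by positivity
  rw [deriv_wellFun_sub_sq hρ, div_le_div_iff₀ (by positivity) h]
  have h1 : s ^ 2 + ρ ^ 2 ≤ 5 / 4 * ρ ^ 2 := by linarith
  have h2 : (s ^ 2 + ρ ^ 2) ^ 2 ≤ (5 / 4 * ρ ^ 2) ^ 2 := pow_le_pow_left₀ (by positivity) h1 2
  nlinarith [mul_le_mul_of_nonneg_right hs (sq_nonneg ρ)]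

/-- In units of `1/ρ²`: for `|s| ≤ ρ/2` the correction gives `8/25 - 7/100 = 1/4`; beyond, the
potential gives `bρ⁴/4 ≥ 1`, which absorbs the losses `1/3` and `7/100`. -/
theorem wellFun_coercive (hρ : 0 < ρ) {V : ℝ → ℝ} {b e : ℝ} (hb : 4 ≤ b * ρ ^ 4)
    (he : e ≤ 7 / 100 / ρ ^ 2) (hV : ∀ s, -e + b * min (s ^ 2) (ρ ^ 2 / 4) ≤ V s) (s : ℝ) :
    1 / 4 / ρ ^ 2 ≤ V s + (deriv (wellFun ρ) s - wellFun ρ s ^ 2) := by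
  have hb0 : 0 < b := by
    by_contra h
    nlinarith [mul_nonneg (neg_nonneg.mpr (not_lt.mp h)) (by positivity : 0 ≤ ρ ^ 4)]
  have hr : 0 < 1 / ρ ^ 2 := by positivity
  have c₁ : 1 / 4 / ρ ^ 2 = 1 / 4 * (1 / ρ ^ 2) := by ring
  have c₂ : 7 / 100 / ρ ^ 2 = 7 / 100 * (1 / ρ ^ 2) := by ring
  have c₃ : 8 / 25 / ρ ^ 2 = 8 / 25 * (1 / ρ ^ 2) := by ring
  have c₄ : 1 / (3 * ρ ^ 2) = 1 / 3 * (1 / ρ ^ 2) := by field_simp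
  have := hV s
  rcases le_total (s ^ 2) (ρ ^ 2 / 4) with hs | hs
  · have h1 := le_deriv_wellFun_sub_sq hρ hs
    have h2 : 0 ≤ b * min (s ^ 2) (ρ ^ 2 / 4) := by positivity
    linarith
  · have h1 := neg_le_deriv_wellFun_sub_sq hρ s
    rw [min_eq_right hs] at this
    have h2 : 1 / ρ ^ 2 ≤ b * (ρ ^ 2 / 4) := by
      rw [div_le_iff₀ (by positivity)]
      nlinarith
    linarith

/-- Norm resolvent convergence for potentials `V ε ≥ -C ε + b min(s², 1/ε)` which converge locally
uniformly to `V₀`. -/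
theorem exists_inverse_tendsto {V : ℝ → ℝ → ℝ} {V₀ : ℝ → ℝ} {b C : ℝ} (hb : 0 < b)
    (hm₀ : Measurable V₀) (hl₀ : IsLocallyBounded V₀) (h₀ : ∀ s, b * s ^ 2 ≤ V₀ s)
    (hV : ∀ᶠ ε in 𝓝[>] (0 : ℝ), Measurable (V ε) ∧ IsLocallyBounded (V ε) ∧
      ∀ s, -(C * ε) + b * min (s ^ 2) ε⁻¹ ≤ V ε s)
    (hconv : ∀ R η, 0 < η → ∀ᶠ ε in 𝓝[>] (0 : ℝ), ∀ s, |s| ≤ R → |V₀ s - V ε s| ≤ η) :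
    ∃ (A : L2 →L[ℂ] L2) (B : ℝ → L2 →L[ℂ] L2), IsBoundedInverse (schrodinger V₀) A ∧
      (∀ᶠ ε in 𝓝[>] (0 : ℝ), IsBoundedInverse (schrodinger (V ε)) (B ε)) ∧
      Tendsto (fun ε => ‖B ε - A‖) (𝓝[>] (0 : ℝ)) (𝓝 0) := by
  obtain ⟨ρ, hρ, hbρ⟩ : ∃ ρ : ℝ, 0 < ρ ∧ 4 ≤ b * ρ ^ 4 := by
    have h1 : 0 < 4 / b := by positivity
    refine ⟨√(√(4 / b)), by positivity, ?_⟩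
    have : √(√(4 / b)) ^ 4 = 4 / b := by
      rw [show 4 = 2 * 2 from rfl, pow_mul, Real.sq_sqrt (by positivity), Real.sq_sqrt h1.le]
    rw [this, mul_div_cancel₀ _ hb.ne']
  set κ : ℝ → ℝ := fun s => deriv (wellFun ρ) s - wellFun ρ s ^ 2
  have hκc : Continuous κ := ((contDiff_wellFun hρ).continuous_deriv (by simp)).sub
    ((contDiff_wellFun hρ).continuous.pow 2)
  have hid : ∀ U : ℝ → ℝ, (fun s => U s + κ s - deriv (wellFun ρ) s + wellFun ρ s ^ 2) = U :=
    fun U => funext fun s => by simp only [κ]; ring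
  have data : ∀ {U : ℝ → ℝ} {e : ℝ}, Measurable U → e ≤ 7 / 100 / ρ ^ 2 →
      (∀ s, -e + b * min (s ^ 2) (ρ ^ 2 / 4) ≤ U s) →
      IsFormData (wellFun ρ) (fun s => U s + κ s) (1 / 4 / ρ ^ 2) := fun hU he h =>
    ⟨contDiff_wellFun hρ, ⟨_, abs_wellFun_le hρ⟩, hU.add hκc.measurable, by positivity,
      wellFun_coercive hρ hbρ he h⟩
  have H₀ := data (e := 0) hm₀ (by positivity) fun s => by
    refine le_trans ?_ (h₀ s)
    have := mul_le_mul_of_nonneg_left (min_le_left (s ^ 2) (ρ ^ 2 / 4)) hb.le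
    linarith
  have small : ∀ {D t : ℝ}, 0 < t → ∀ᶠ ε in 𝓝[>] (0 : ℝ), D * ε ≤ t := by
    intro D t ht
    have : Tendsto (fun ε : ℝ => D * ε) (𝓝[>] 0) (𝓝 (D * 0)) :=
      (tendsto_id.mono_left nhdsWithin_le_nhds).const_mul D
    rw [mul_zero] at this
    exact this.eventually_le_const ht
  have H : ∀ᶠ ε in 𝓝[>] (0 : ℝ),
      IsFormData (wellFun ρ) (fun s => V ε s + κ s) (1 / 4 / ρ ^ 2) := by
    filter_upwards [hV, small (D := C) (t := 7 / 100 / ρ ^ 2) (by positivity),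
      small (D := 1) (t := (ρ ^ 2 / 4)⁻¹) (by positivity), self_mem_nhdsWithin]
      with ε ⟨h1, _, h2⟩ h3 h4 h5
    refine data h1 h3 fun s => le_trans ?_ (h2 s)
    rw [one_mul] at h4
    have : ρ ^ 2 / 4 ≤ ε⁻¹ := (le_inv_comm₀ (by positivity) h5).mpr h4
    gcongr
  obtain ⟨A, hA⟩ := H₀.exists_isFormInverse
  -- Where the form data fail, `B ε` is an arbitrary operator; this does not occur for small `ε >
  -- 0`.
  choose! B hB using fun (ε : ℝ) (h : IsFormData (wellFun ρ) (fun s => V ε s + κ s)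
    (1 / 4 / ρ ^ 2)) => h.exists_isFormInverse
  have hlb : ∀ {U : ℝ → ℝ}, IsLocallyBounded U → IsLocallyBounded fun s => U s + κ s :=
    fun hU => hU.add hκc.isLocallyBounded
  refine ⟨A, B, ?_, ?_, ?_⟩
  · have := hA.isBoundedInverse H₀ (hlb hl₀)
    rwa [hid] at this
  · filter_upwards [H, hV] with ε h1 h2
    have := (hB ε h1).isBoundedInverse h1 (hlb h2.2.1)
    rwa [hid] at this
  · refine tendsto_norm_sub_isFormInverse (Q := fun ε s => V ε s + κ s) hA H₀ (hlb hl₀) ?_ ?_ ?_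
    · filter_upwards [H, hV] with ε h1 h2
      exact ⟨h1, hlb h2.2.1, hB ε h1⟩
    · intro R η hη
      filter_upwards [hconv R η hη] with ε h s hs
      simpa using h s hs
    · intro K
      -- The second summand pays for the negative part of `κ`, the last for `-C ε ≥ -1`.
      set K' := |K| + 1 / (3 * ρ ^ 2) + 1
      have hK' : 0 < K' := by positivity
      refine ⟨√(K' / b), ?_⟩
      filter_upwards [hV, small (D := C) one_pos, small (D := K' / b) one_pos,
        self_mem_nhdsWithin] with ε ⟨_, _, h2⟩ h3 h4 h5 s hs
      have hs2 : K' / b ≤ s ^ 2 := by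
        rw [← sq_abs]
        exact Real.sqrt_le_left (abs_nonneg s) |>.mp hs
      have hε : K' / b ≤ ε⁻¹ := by rwa [← one_div, le_div_iff₀ h5]
      have hKb : b * (K' / b) = K' := mul_div_cancel₀ _ hb.ne'
      have h6 := mul_le_mul_of_nonneg_left (le_min hs2 hε) hb.le
      have h7 := mul_le_mul_of_nonneg_left hs2 hb.le
      have h8 : -(1 / (3 * ρ ^ 2)) ≤ κ s := neg_le_deriv_wellFun_sub_sq hρ s
      have h9 := le_abs_self K
      rw [hKb] at h6 h7
      constructor
      · linarith [h₀ s]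
      · linarith [h2 s]

/-! ### The deformation function -/

variable {h : ℝ → ℝ} {M : ℝ}

theorem IsDeformation.apply_zero (hh : IsDeformation h M) : h 0 = M := by
  obtain ⟨C, hC⟩ := hh.expansion.bound
  have := hC.self_of_nhds
  simp only [abs_zero, ne_eq, OfNat.ofNat_ne_zero, not_false_eq_true, zero_pow, sub_zero,
    norm_zero, mul_zero, norm_le_zero_iff] at this
  linarith

theorem IsDeformation.le_max (hh : IsDeformation h M) (s : ℝ) : h s ≤ M := by
  rw [← hh.apply_zero]
  rcases eq_or_ne s 0 with rfl | hs
  · exact le_rfl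
  · exact (hh.single_max s hs).le

/-- The function `1 / h² - 1 / M²`. -/
def well (h : ℝ → ℝ) (M s : ℝ) : ℝ := (h s ^ 2)⁻¹ - (M ^ 2)⁻¹

theorem IsDeformation.continuous_well (hh : IsDeformation h M) : Continuous (well h M) :=
  ((hh.continuous.pow 2).inv₀ fun s => (pow_pos (hh.pos s) 2).ne').sub continuous_const

theorem IsDeformation.well_nonneg (hh : IsDeformation h M) (s : ℝ) : 0 ≤ well h M s :=
  sub_nonneg.mpr (inv_anti₀ (pow_pos (hh.pos s) 2)
    (pow_le_pow_left₀ (hh.pos s).le (hh.le_max s) 2))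

/-- Factor `1/h² - 1/M² = (M - h)(M + h)/(h²M²)`: the quotient `(M - h)/s²` tends to `1`, the
remaining factor to `2M/M⁴`. -/
theorem IsDeformation.well_expansion (hh : IsDeformation h M) {η : ℝ} (hη : 0 < η) :
    ∃ δ, 0 < δ ∧ ∀ s, |s| ≤ δ → |well h M s - 2 / M ^ 3 * s ^ 2| ≤ η * s ^ 2 := by
  have hM := hh.max_pos
  obtain ⟨C, hC⟩ := hh.expansion.bound
  have t₁ : Tendsto (fun s => (M - h s) / s ^ 2) (𝓝[≠] 0) (𝓝 1) := by
    rw [tendsto_iff_norm_sub_tendsto_zero]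
    have t : Tendsto (fun s : ℝ => C * |s|) (𝓝[≠] 0) (𝓝 0) := by
      have : Tendsto (fun s : ℝ => C * |s|) (𝓝 0) (𝓝 (C * |0|)) :=
        (continuous_const.mul continuous_abs).tendsto 0
      rw [abs_zero, mul_zero] at this
      exact this.mono_left nhdsWithin_le_nhds
    refine squeeze_zero' (Eventually.of_forall fun s => norm_nonneg _) ?_ t
    filter_upwards [nhdsWithin_le_nhds hC, self_mem_nhdsWithin] with s hs hs0
    have hs2 : 0 < |s| ^ 2 := pow_pos (abs_pos.mpr hs0) 2
    have e : (M - h s) / s ^ 2 - 1 = -(h s - (M - s ^ 2)) / |s| ^ 2 := by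
      rw [sq_abs]
      field_simp [show s ≠ 0 from hs0]
      ring
    rw [e, norm_div, norm_neg, Real.norm_of_nonneg hs2.le, div_le_iff₀ hs2]
    refine hs.trans_eq ?_
    rw [norm_pow, Real.norm_eq_abs, abs_abs]
    ring
  have t₂ : Tendsto (fun s => (M + h s) / (h s ^ 2 * M ^ 2)) (𝓝[≠] 0) (𝓝 (2 / M ^ 3)) := by
    have hc : Continuous fun s => (M + h s) / (h s ^ 2 * M ^ 2) :=
      (continuous_const.add hh.continuous).div ((hh.continuous.pow 2).mul continuous_const)
        fun s => (mul_pos (pow_pos (hh.pos s) 2) (pow_pos hM 2)).ne'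
    have e : (M + h 0) / (h 0 ^ 2 * M ^ 2) = 2 / M ^ 3 := by
      rw [hh.apply_zero]
      field_simp
      ring
    rw [← e]
    exact (hc.tendsto 0).mono_left nhdsWithin_le_nhds
  have t₃ : Tendsto (fun s => well h M s / s ^ 2) (𝓝[≠] 0) (𝓝 (2 / M ^ 3)) := by
    have := t₁.mul t₂
    rw [one_mul] at this
    refine this.congr fun s => ?_
    have := (hh.pos s).ne'
    have e : well h M s = (M - h s) * (M + h s) / (h s ^ 2 * M ^ 2) := by
      rw [well]
      field_simp
      ring
    rw [e, div_mul_div_comm, mul_comm (s ^ 2), div_mul_eq_div_div]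
  have := (tendsto_iff_norm_sub_tendsto_zero.mp t₃).eventually_le_const hη
  rw [eventually_nhdsWithin_iff, Metric.eventually_nhds_iff] at this
  obtain ⟨δ, hδ, hs⟩ := this
  refine ⟨δ / 2, by positivity, fun s hsδ => ?_⟩
  rcases eq_or_ne s 0 with rfl | hs0
  · simp [well, hh.apply_zero]
  · have h1 := hs (y := s) (by rw [dist_zero_right, Real.norm_eq_abs]; linarith) hs0
    have hs2 : 0 < s ^ 2 := by positivity
    have e : well h M s - 2 / M ^ 3 * s ^ 2 = (well h M s / s ^ 2 - 2 / M ^ 3) * s ^ 2 := by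
      field_simp
    rw [e, abs_mul, abs_of_pos hs2]
    exact mul_le_mul_of_nonneg_right h1 hs2.le

/-- Near infinity the limsup condition gives the gap; on the remaining compact set `h` attains a
maximum at a nonzero point. -/
theorem IsDeformation.exists_lt_max (hh : IsDeformation h M) {δ : ℝ} (hδ : 0 < δ) :
    ∃ m, 0 < m ∧ m < M ∧ ∀ s, δ ≤ |s| → h s ≤ m := by
  obtain ⟨m₁, h1, h2⟩ := exists_between hh.limsup_lt
  have hev : ∀ᶠ s in cocompact ℝ, h s < m₁ :=
    eventually_lt_of_limsup_lt h1 ⟨M, eventually_map.mpr (Eventually.of_forall hh.le_max)⟩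
  obtain ⟨K, hK, hKs⟩ := mem_cocompact.mp hev
  -- Inserting `δ` ensures that the set is nonempty.
  have hK' : IsCompact (insert δ K ∩ {s : ℝ | δ ≤ |s|}) :=
    (hK.insert δ).inter_right (isClosed_le continuous_const continuous_abs)
  obtain ⟨x, hx, hmax⟩ := hK'.exists_isMaxOn ⟨δ, mem_insert _ _, le_abs_self δ⟩
    hh.continuous.continuousOn
  have hx0 : x ≠ 0 := by
    rintro rfl
    have : δ ≤ |(0 : ℝ)| := hx.2
    rw [abs_zero] at this
    linarith
  refine ⟨max m₁ (h x), lt_max_of_lt_right (hh.pos x), max_lt h2 ?_, fun s hs => ?_⟩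
  · rw [← hh.apply_zero]
    exact hh.single_max x hx0
  · by_cases hsK : s ∈ K
    · exact le_max_of_le_right (hmax ⟨mem_insert_of_mem _ hsK, hs⟩)
    · have : h s < m₁ := hKs hsK
      exact le_max_of_le_left this.le

/-- Near `0`, the error `s²/M³` leaves half of the leading term; away from `0` the gap below the
maximum is used. The bound `b ≤ 1/M³` lets the limit potential satisfy the same lower bound. -/
theorem IsDeformation.exists_well_lower_bound (hh : IsDeformation h M) :
    ∃ b, 0 < b ∧ b ≤ 1 / M ^ 3 ∧ ∀ s, b * min (s ^ 2) 1 ≤ well h M s := by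
  have hM := hh.max_pos
  obtain ⟨δ, hδ, hs⟩ := hh.well_expansion (η := 1 / M ^ 3) (by positivity)
  obtain ⟨m, hm, hmM, hms⟩ := hh.exists_lt_max hδ
  set b₂ := (m ^ 2)⁻¹ - (M ^ 2)⁻¹
  have hb₂ : 0 < b₂ := sub_pos.mpr (inv_strictAnti₀ (pow_pos hm 2)
    (pow_lt_pow_left₀ hmM hm.le two_ne_zero))
  refine ⟨min (1 / M ^ 3) b₂, lt_min (by positivity) hb₂, min_le_left _ _, fun s => ?_⟩
  rcases le_total |s| δ with h1 | h1
  · have h2 := (abs_le.mp (hs s h1)).1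
    have h3 : min (1 / M ^ 3) b₂ * min (s ^ 2) 1 ≤ 1 / M ^ 3 * s ^ 2 :=
      mul_le_mul (min_le_left _ _) (min_le_left _ _) (by positivity) (by positivity)
    have h4 : 2 / M ^ 3 * s ^ 2 = 1 / M ^ 3 * s ^ 2 + 1 / M ^ 3 * s ^ 2 := by ring
    linarith
  · have h3 : min (1 / M ^ 3) b₂ * min (s ^ 2) 1 ≤ b₂ * 1 :=
      mul_le_mul (min_le_right _ _) (min_le_right _ _) (by positivity) hb₂.le
    have h4 : (m ^ 2)⁻¹ ≤ (h s ^ 2)⁻¹ :=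
      inv_anti₀ (pow_pos (hh.pos s) 2) (pow_le_pow_left₀ (hh.pos s).le (hms s h1) 2)
    rw [well]
    linarith

theorem IsDeformation.exists_log_deriv_bound (hh : IsDeformation h M) :
    ∃ C, ∀ s, |deriv h s / h s| ≤ C := by
  obtain ⟨C, hC⟩ := hh.bounded_log_deriv
  refine ⟨max C |deriv h 0 / h 0|, fun s => ?_⟩
  rcases eq_or_ne s 0 with rfl | hs
  · exact le_max_right _ _
  · exact le_max_of_le_left (hC s hs)

/-! ### The rescaled effective potential -/

/-- The potential `ε θ(√ε s) + ζ_ε(√ε s) (λ / ε) (1 / h(√ε s)² - 1 / M²)`. -/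
def scaledPot (lam : ℝ) (θ : ℝ → ℝ) (ζ : ℝ → ℝ → ℝ) (h : ℝ → ℝ) (M ε s : ℝ) : ℝ :=
  ε * θ (√ε * s) + ζ ε (√ε * s) * (lam / ε * well h M (√ε * s))

variable {lam C : ℝ} {θ : ℝ → ℝ} {ζ : ℝ → ℝ → ℝ}

/-- Half of the well survives because `ζ ≥ 1/2`; rescaling turns `min(s², 1)/ε` into `min(s², 1/ε)`.
-/
theorem scaledPot_lower_bound (hh : IsDeformation h M) (hlam : 0 < lam) (hθ : ∀ s, |θ s| ≤ C)
    {b : ℝ} (hbw : ∀ s, b * min (s ^ 2) 1 ≤ well h M s) {ε : ℝ} (hε : 0 < ε)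
    (hζ : ∀ s, |ζ ε s - 1| ≤ 1 / 2) (s : ℝ) :
    -(C * ε) + lam * b / 2 * min (s ^ 2) ε⁻¹ ≤ scaledPot lam θ ζ h M ε s := by
  have h1 := (abs_le.mp (hθ (√ε * s))).1
  have h2 := (abs_le.mp (hζ (√ε * s))).1
  have h3 := hbw (√ε * s)
  have h4 : min (s ^ 2) ε⁻¹ = ε⁻¹ * min ((√ε * s) ^ 2) 1 := by
    rw [mul_min_of_nonneg _ _ (inv_nonneg.mpr hε.le), mul_pow, Real.sq_sqrt hε.le,
      inv_mul_cancel_left₀ hε.ne', mul_one]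
  have h5 : lam * b / 2 * min (s ^ 2) ε⁻¹ ≤ 1 / 2 * (lam / ε * well h M (√ε * s)) := by
    rw [h4]
    have := mul_le_mul_of_nonneg_left h3 (by positivity : 0 ≤ 1 / 2 * (lam / ε))
    refine le_trans (le_of_eq ?_) (this.trans_eq ?_)
    · rw [div_eq_mul_inv lam ε]
      ring
    · ring
  have h6 : 1 / 2 * (lam / ε * well h M (√ε * s))
      ≤ ζ ε (√ε * s) * (lam / ε * well h M (√ε * s)) :=
    mul_le_mul_of_nonneg_right (by linarith)
      (mul_nonneg (by positivity) (hh.well_nonneg _))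
  have h7 : ε * -C ≤ ε * θ (√ε * s) := mul_le_mul_of_nonneg_left h1 hε.le
  rw [scaledPot]
  linarith

theorem scaledPot_tendsto (hh : IsDeformation h M) (hlam : 0 < lam) (hθ : ∀ s, |θ s| ≤ C)
    {D : ℝ} (hζ : ∀ ε, 0 < ε → ∀ s, |ζ ε s - 1| ≤ D * ε) (R : ℝ) {η : ℝ} (hη : 0 < η) :
    ∀ᶠ ε in 𝓝[>] (0 : ℝ), ∀ s, |s| ≤ R →
      |2 * lam / M ^ 3 * s ^ 2 - scaledPot lam θ ζ h M ε s| ≤ η := by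
  have hM := hh.max_pos
  -- The cap `1` bounds the well by a fixed multiple of `x²`; the other term keeps the Taylor error
  -- below `η/2` on `|s| ≤ R`. The other half of `η` covers `θ` and `ζ - 1`.
  set η' := min 1 (η / (2 * lam * (R ^ 2 + 1)))
  have hη' : 0 < η' := lt_min one_pos (by positivity)
  obtain ⟨δ, hδ, hw⟩ := hh.well_expansion hη'
  have t₁ : Tendsto (fun ε : ℝ => √ε * |R|) (𝓝[>] 0) (𝓝 0) := by
    have : Tendsto (fun ε : ℝ => √ε * |R|) (𝓝 0) (𝓝 (√0 * |R|)) :=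
      (Real.continuous_sqrt.mul continuous_const).tendsto 0
    rw [Real.sqrt_zero, zero_mul] at this
    exact this.mono_left nhdsWithin_le_nhds
  have t₂ : Tendsto (fun ε : ℝ => ε * (C + D * (lam * (2 / M ^ 3 + 1) * R ^ 2))) (𝓝[>] 0) (𝓝 0) := by
    have := (tendsto_id.mono_left nhdsWithin_le_nhds : Tendsto id (𝓝[>] (0 : ℝ)) (𝓝 0)).mul_const
      (C + D * (lam * (2 / M ^ 3 + 1) * R ^ 2))
    rwa [zero_mul] at this
  filter_upwards [t₁.eventually_le_const hδ, t₂.eventually_le_const (half_pos hη),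
    self_mem_nhdsWithin] with ε h1 h2 (h3 : 0 < ε) s hs
  have hs2 : s ^ 2 ≤ R ^ 2 := by
    rw [← sq_abs s]
    exact pow_le_pow_left₀ (abs_nonneg s) hs 2
  set x := √ε * s
  have hx2 : x ^ 2 = ε * s ^ 2 := by rw [mul_pow, Real.sq_sqrt h3.le]
  have hx : |x| ≤ δ := by
    rw [abs_mul, abs_of_nonneg (Real.sqrt_nonneg ε)]
    exact (mul_le_mul_of_nonneg_left (hs.trans (le_abs_self R)) (Real.sqrt_nonneg ε)).trans h1
  have h4 := hw x hx
  have hle : 0 < lam / ε := by positivity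
  have e : 2 * lam / M ^ 3 * s ^ 2 - scaledPot lam θ ζ h M ε s
      = -(ε * θ x) - (ζ ε x - 1) * (lam / ε * well h M x)
        - lam / ε * (well h M x - 2 / M ^ 3 * x ^ 2) := by
    rw [scaledPot, hx2]
    change _ - (ε * θ x + ζ ε x * (lam / ε * well h M x)) = _
    field_simp
    ring
  have b₁ : |ε * θ x| ≤ ε * C := by
    rw [abs_mul, abs_of_pos h3]
    exact mul_le_mul_of_nonneg_left (hθ x) h3.le
  have b₂ : |lam / ε * (well h M x - 2 / M ^ 3 * x ^ 2)| ≤ η / 2 := by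
    rw [abs_mul, abs_of_pos hle]
    refine (mul_le_mul_of_nonneg_left h4 hle.le).trans ?_
    have e' : lam / ε * (η' * x ^ 2) = lam * η' * s ^ 2 := by
      rw [hx2]
      field_simp
    have h5 : η' ≤ η / (2 * lam * (R ^ 2 + 1)) := min_le_right _ _
    rw [le_div_iff₀ (by positivity)] at h5
    rw [e']
    have : lam * η' * s ^ 2 ≤ lam * η' * (R ^ 2 + 1) :=
      mul_le_mul_of_nonneg_left (by linarith) (by positivity)
    linarith
  have b₃ : |lam / ε * well h M x| ≤ lam * (2 / M ^ 3 + 1) * R ^ 2 := by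
    rw [abs_of_nonneg (mul_nonneg hle.le (hh.well_nonneg x))]
    have h5 : well h M x ≤ (2 / M ^ 3 + 1) * x ^ 2 := by
      have h6 := (abs_le.mp h4).2
      have h7 : η' * x ^ 2 ≤ 1 * x ^ 2 := mul_le_mul_of_nonneg_right (min_le_left _ _) (sq_nonneg x)
      linarith
    refine (mul_le_mul_of_nonneg_left h5 hle.le).trans ?_
    have e' : lam / ε * ((2 / M ^ 3 + 1) * x ^ 2) = lam * (2 / M ^ 3 + 1) * s ^ 2 := by
      rw [hx2]
      field_simp
    rw [e']
    exact mul_le_mul_of_nonneg_left hs2 (by positivity)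
  have b₄ : |(ζ ε x - 1) * (lam / ε * well h M x)| ≤ D * ε * (lam * (2 / M ^ 3 + 1) * R ^ 2) := by
    rw [abs_mul]
    exact mul_le_mul (hζ ε h3 x) b₃ (abs_nonneg _) ((abs_nonneg _).trans (hζ ε h3 x))
  rw [e]
  refine (abs_sub _ _).trans ((add_le_add_left (abs_sub _ _) _).trans ?_)
  rw [abs_neg]
  linarith

theorem measurable_scaledPot (hh : IsDeformation h M) (hθ : Measurable θ) {ε : ℝ}
    (hζ : Measurable (ζ ε)) : Measurable (scaledPot lam θ ζ h M ε) := by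
  have hx : Measurable fun s : ℝ => √ε * s := measurable_const_mul _
  exact ((hθ.comp hx).const_mul ε).add ((hζ.comp hx).mul
    ((hh.continuous_well.measurable.comp hx).const_mul _))

theorem isLocallyBounded_of_abs_le {m : ℝ → ℝ} (hm : ∀ s, |m s| ≤ C) : IsLocallyBounded m :=
  fun _ => ⟨C, fun s _ => hm s⟩

theorem isLocallyBounded_scaledPot (hh : IsDeformation h M) (hθ : ∀ s, |θ s| ≤ C) {ε D : ℝ}
    (hζ : ∀ s, |ζ ε s - 1| ≤ D) : IsLocallyBounded (scaledPot lam θ ζ h M ε) := by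
  have hζ' : ∀ s, |ζ ε s| ≤ D + 1 := fun s => by
    have := abs_add_le (ζ ε s - 1) 1
    rw [sub_add_cancel, abs_one] at this
    linarith [hζ s]
  have l₁ : IsLocallyBounded fun s => θ (√ε * s) := isLocallyBounded_of_abs_le fun s => hθ _
  have l₂ : IsLocallyBounded fun s => ζ ε (√ε * s) := isLocallyBounded_of_abs_le fun s => hζ' _
  have l₃ : Continuous fun s => lam / ε * well h M (√ε * s) :=
    continuous_const.mul (hh.continuous_well.comp (continuous_const.mul continuous_id))
  exact ((continuous_const (y := ε)).isLocallyBounded.mul l₁).add (l₂.mul l₃.isLocallyBounded)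

/-! ### The data of the tube -/

/-- The Frenet equations recover `k` as `⟨r'', N⟩`, and derivatives are measurable; the torsion is
obtained in the same way from `B'`. -/
theorem IsFrenetCurve.measurable_curvature {r N B : ℝ → E3} {k τ : ℝ → ℝ}
    (hr : IsFrenetCurve r N B k τ) : Measurable k := by
  have hN : Continuous N := continuous_iff_continuousAt.mpr fun s => (hr.frenet_N s).continuousAt
  have e : k = fun s => inner ℝ (deriv (deriv r) s) (N s) := by
    funext s
    rw [(hr.frenet_T s).deriv, real_inner_smul_left, real_inner_self_eq_norm_sq, hr.norm_normal]
    ring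
  rw [e]
  exact (measurable_deriv (deriv r)).inner hN.measurable

theorem IsFrenetCurve.measurable_torsion {r N B : ℝ → E3} {k τ : ℝ → ℝ}
    (hr : IsFrenetCurve r N B k τ) : Measurable τ := by
  have hN : Continuous N := continuous_iff_continuousAt.mpr fun s => (hr.frenet_N s).continuousAt
  have e : τ = fun s => -inner ℝ (deriv B s) (N s) := by
    funext s
    rw [(hr.frenet_B s).deriv, real_inner_smul_left, real_inner_self_eq_norm_sq, hr.norm_normal]
    ring
  rw [e]
  exact ((measurable_deriv B).inner hN.measurable).neg

theorem norm_zvec (α : ℝ → ℝ) (s : ℝ) : ‖zvec α s‖ = 1 := by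
  rw [EuclideanSpace.norm_eq, Fin.sum_univ_two]
  simp [zvec]

theorem abs_zeta_sub_one_le (S : Set E2) (u0 : E2 → ℝ) {k : ℝ → ℝ} (α : ℝ → ℝ)
    (hh : IsDeformation h M) {D : ℝ} (hk : ∀ s, |k s| ≤ D) {ε : ℝ} (hε : 0 < ε) (s : ℝ) :
    |zeta S u0 k α h ε s - 1| ≤ D * M * ‖FS S u0‖ * ε := by
  have h1 : |inner ℝ (zvec α s) (FS S u0)| ≤ ‖FS S u0‖ := by
    have := abs_real_inner_le_norm (zvec α s) (FS S u0)
    rwa [norm_zvec, one_mul] at this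
  have h2 : |h s| ≤ M := by
    rw [abs_of_pos (hh.pos s)]
    exact hh.le_max s
  have h3 : |k s| * |h s| ≤ D * M :=
    mul_le_mul (hk s) h2 (abs_nonneg _) ((abs_nonneg _).trans (hk s))
  have h4 : |k s| * |h s| * |inner ℝ (zvec α s) (FS S u0)| ≤ D * M * ‖FS S u0‖ :=
    mul_le_mul h3 h1 (abs_nonneg _) ((mul_nonneg (abs_nonneg _) (abs_nonneg _)).trans h3)
  have e : zeta S u0 k α h ε s - 1 = -(ε * k s * h s * inner ℝ (zvec α s) (FS S u0)) := by
    rw [zeta]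
    ring
  rw [e, abs_neg, abs_mul, abs_mul, abs_mul, abs_of_pos hε]
  nlinarith

theorem measurable_zeta (S : Set E2) (u0 : E2 → ℝ) {k α : ℝ → ℝ} (hk : Measurable k)
    (hα : Continuous α) (hh : IsDeformation h M) (ε : ℝ) : Measurable (zeta S u0 k α h ε) := by
  have hz : Continuous (zvec α) := by
    unfold zvec
    fun_prop
  exact measurable_const.sub (((hk.const_mul ε).mul hh.continuous.measurable).mul
    (hz.inner continuous_const).measurable)

/-- A polynomial in the two bounded quantities `τ + α'` and `h'/h` is bounded on a compact
rectangle. -/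
theorem exists_vartheta_bound (S : Set E2) (Du0 : E2 → E2) {τ α : ℝ → ℝ}
    (hτ : ∃ C, ∀ s, |τ s| ≤ C) (hα : ∃ C, ∀ s, |deriv α s| ≤ C) (hh : IsDeformation h M) (c : ℝ) :
    ∃ C, ∀ s, |vartheta S Du0 τ α h s + c| ≤ C := by
  obtain ⟨C₁, h₁⟩ := hτ
  obtain ⟨C₂, h₂⟩ := hα
  obtain ⟨C₃, h₃⟩ := hh.exists_log_deriv_bound
  set K := isCompact_Icc (a := -(C₁ + C₂)) (b := C₁ + C₂) |>.prod
    (isCompact_Icc (a := -C₃) (b := C₃))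
  obtain ⟨C, hC⟩ := K.exists_bound_of_continuousOn
    (f := fun p : ℝ × ℝ => C1 S Du0 * p.1 ^ 2 + (C2 S Du0 - 1) * p.2 ^ 2
      - 2 * C3 S Du0 * p.1 * p.2 + c) (by fun_prop)
  refine ⟨C, fun s => hC (τ s + deriv α s, deriv h s / h s) ⟨?_, ?_⟩⟩
  · exact abs_le.mp ((abs_add_le _ _).trans (add_le_add (h₁ s) (h₂ s)))
  · exact abs_le.mp (h₃ s)

theorem measurable_vartheta (S : Set E2) (Du0 : E2 → E2) {τ α : ℝ → ℝ} (hτ : Measurable τ)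
    (hh : IsDeformation h M) : Measurable (vartheta S Du0 τ α h) := by
  have h₁ : Measurable fun s => τ s + deriv α s := hτ.add (measurable_deriv α)
  have h₂ : Measurable fun s => deriv h s / h s := (measurable_deriv h).div hh.continuous.measurable
  exact (((h₁.pow_const 2).const_mul _).add ((h₂.pow_const 2).const_mul _)).sub
    ((h₁.const_mul _).mul h₂)

theorem scaledPot_eq (S : Set E2) (lam0 : ℝ) (u0 : E2 → ℝ) (Du0 : E2 → E2) (k τ α : ℝ → ℝ)
    (c : ℝ) {ε : ℝ} (hε : 0 < ε) :
    (fun s => ε * Wpot S lam0 u0 Du0 k τ α h M c ε (√ε * s))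
      = scaledPot lam0 (fun s => vartheta S Du0 τ α h s + c) (zeta S u0 k α h) h M ε := by
  funext s
  rw [Wpot, scaledPot, well]
  have e : ∀ m : ℝ, ε * (lam0 / (ε ^ 2 * m)) = lam0 / ε * m⁻¹ := fun m => by
    rw [pow_two, mul_assoc, div_mul_eq_div_div, mul_div_assoc', mul_div_cancel₀ _ hε.ne',
      div_mul_eq_div_div, div_eq_mul_inv (lam0 / ε)]
  rw [mul_add, mul_left_comm ε, mul_sub ε, e, e, mul_sub (lam0 / ε)]

end DeformedTube

end

/-! ### Norm resolvent convergence of the rescaled operators. -/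

theorem mainTheorem5
    (S : Set DeformedTube.E2) (hS : DeformedTube.IsCrossSection S)
    (lam0 : ℝ) (u0 : DeformedTube.E2 → ℝ) (Du0 : DeformedTube.E2 → DeformedTube.E2)
    (hu0 : DeformedTube.IsGroundState S lam0 u0 Du0)
    (r N B : ℝ → DeformedTube.E3) (k τ : ℝ → ℝ) (hr : DeformedTube.IsFrenetCurve r N B k τ)
    (α : ℝ → ℝ) (hα : Differentiable ℝ α) (hα0 : α 0 = 0)
    (hk : ∃ C, ∀ s, |k s| ≤ C) (hτ : ∃ C, ∀ s, |τ s| ≤ C) (hα' : ∃ C, ∀ s, |deriv α s| ≤ C)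
    (h : ℝ → ℝ) (M : ℝ) (hh : DeformedTube.IsDeformation h M) (c : ℝ) :
    ∃ (Tinv : DeformedTube.L2 →L[ℂ] DeformedTube.L2)
      (That_inv : ℝ → DeformedTube.L2 →L[ℂ] DeformedTube.L2),
      DeformedTube.IsBoundedInverse
        (DeformedTube.schrodinger fun s => 2 * lam0 / M ^ 3 * s ^ 2) Tinv ∧
      (∀ᶠ ε in 𝓝[>] (0 : ℝ), DeformedTube.IsBoundedInverse
        (DeformedTube.rescaled ε
          (DeformedTube.schrodinger (DeformedTube.Wpot S lam0 u0 Du0 k τ α h M c ε)))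
        (That_inv ε)) ∧
      Tendsto (fun ε => ‖That_inv ε - Tinv‖) (𝓝[>] (0 : ℝ)) (𝓝 0) := by
  open DeformedTube in
  have hlam := hu0.lam0_pos hS
  have hM := hh.max_pos
  obtain ⟨Ck, hCk⟩ := hk
  obtain ⟨Cθ, hCθ⟩ := exists_vartheta_bound S Du0 hτ hα' hh c
  obtain ⟨b, hb, hbM, hbw⟩ := hh.exists_well_lower_bound
  have hζ := fun (ε : ℝ) (hε : 0 < ε) s => abs_zeta_sub_one_le S u0 α hh hCk hε s
  set D := Ck * M * ‖FS S u0‖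
  have hcont : Continuous fun s : ℝ => 2 * lam0 / M ^ 3 * s ^ 2 := by fun_prop
  have hsmall : ∀ᶠ ε in 𝓝[>] (0 : ℝ), D * ε ≤ 1 / 2 := by
    have : Tendsto (fun ε : ℝ => D * ε) (𝓝[>] 0) (𝓝 (D * 0)) :=
      (tendsto_id.mono_left nhdsWithin_le_nhds).const_mul D
    rw [mul_zero] at this
    exact this.eventually_le_const one_half_pos
  -- The coefficient `λ₀b/2` is the one left after `ζ ≥ 1/2`; it is at most `2λ₀/M³` because `b ≤
  -- 1/M³`.
  obtain ⟨A, B', hA, hB, hlim⟩ := exists_inverse_tendsto (b := lam0 * b / 2) (C := Cθ)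
    (V₀ := fun s => 2 * lam0 / M ^ 3 * s ^ 2)
    (V := scaledPot lam0 (fun s => vartheta S Du0 τ α h s + c) (zeta S u0 k α h) h M)
    (by positivity) hcont.measurable hcont.isLocallyBounded
    (fun s => by
      refine mul_le_mul_of_nonneg_right ?_ (sq_nonneg s)
      have h1 := mul_le_mul_of_nonneg_left hbM hlam.le
      have h2 : 0 < lam0 * b := by positivity
      have h3 : 2 * lam0 / M ^ 3 = 2 * (lam0 * (1 / M ^ 3)) := by ring
      linarith)
    (by
      filter_upwards [hsmall, self_mem_nhdsWithin] with ε h1 (h2 : 0 < ε)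
      have h3 : ∀ s, |zeta S u0 k α h ε s - 1| ≤ 1 / 2 := fun s => (hζ ε h2 s).trans h1
      exact ⟨measurable_scaledPot hh
          ((measurable_vartheta S Du0 hr.measurable_torsion hh).add_const c)
          (measurable_zeta S u0 hr.measurable_curvature hα.continuous hh ε),
        isLocallyBounded_scaledPot hh hCθ h3,
        scaledPot_lower_bound hh hlam hCθ hbw h2 h3⟩)
    (fun R η hη => scaledPot_tendsto hh hlam hCθ hζ R hη)
  refine ⟨A, B', hA, ?_, hlim⟩
  filter_upwards [hB, self_mem_nhdsWithin] with ε h1 (h2 : 0 < ε)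
  rw [← scaledPot_eq S lam0 u0 Du0 k τ α c h2] at h1
  exact h1.rescaled h2
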